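/- **Setting.** Let $\tau:E\to M$ be a Lie algebroid (a smooth, finite-rank vector bundle over a finite-dimensional smooth manifold) with anchor $\rho$. The prolongation $\mathcal T^EE\to E$ has fibre $\mathcal T^E_aE=\{(b,v)\in E_{\tau(a)}\times T_aE:\rho(b)=T_a\tau(v)\}$ at $a\in E$ and is a Lie algebroid with anchor $\rho^1(a,b,v)=v$ and bracket of projectable sections $[(\sigma_1,X_1),(\sigma_2,X_2)]=([\sigma_1,\sigma_2],[X_1,X_2])$. For $b\in E_{\tau(a)}$ let $b_a^V\in T_aE$ be the tangent vector of $t\mapsto a+tb$ at $t=0$; put $S(a,b,v)=(a,0,b_a^V)$ and $\Delta(a)=(a,0,a_a^V)$. For $L\in C^\infty(E)$ put $\theta_L=S^*(dL)$, $\omega_L=-d\theta_L$, $E_L=d_\Delta L-L$, where $d$ is the exterior differential of the Lie algebroid $\mathcal T^EE$. The Lagrangian $L$ is regular if $\omega_L$ is nondegenerate at every point. Let $\mathcal M\subset E$ be an embedded submanifold such that $\pi=\tau|_{\mathcal M}:\mathcal M\to M$ is a surjective submersion. For $a\in\mathcal M$ put $\mathcal T^E_a\mathcal M=\{(b,v)\in\mathcal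 T^E_aE: v\in T_a\mathcal M\}$, $\mathcal V_a=\{b\in E_{\tau(a)}: b_a^V\in T_a\mathcal M\}$ and $\Psi_a=S^*\big((\mathcal T^E_a\mathcal M)^\circ\big)$, where $(\cdot)^\circ$ is the annihilator in $(\mathcal T^E_aE)^*$. A solution of the Lagrange–d'Alembert equations of $(L,\mathcal M)$ is a smooth section $\Gamma$ of $\mathcal T^E\mathcal M\to\mathcal M$ with $(i_\Gamma\omega_L-dE_L)(a)\in\Psi_a$ for all $a\in\mathcal M$. The system $(L,\mathcal M)$ is regular if there is exactly one solution, which is then denoted $\Gamma_{(L,\mathcal M)}$ and called the constrained dynamics; the solutions of the Lagrange–d'Alembert differential equations (constrained trajectories) are the integral curves of the vector field $\rho^1(\Gamma_{(L,\mathcal M)})$ on $\mathcal M$. **Theorem.** Let $E\to M$ and $E'\to M'$ be Lie algebroids, $L\in C^\infty(E)$ a regular Lagrangian, $L'\in C^\infty(E')$, and $\mathcal M\subset E$, $\mathcal M'\subset E'$ constraint submanifolds as above, with $(L,\mathcal M)$ regular. Let $\Phi:E\to E'$ be a fiberwise surjective morphism of Lie algebroids over a surjective submersion $\phi:M\to M'$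 (that is, $\Phi^\star d\beta=d\Phi^\star\beta$ for all forms $\beta$ on $E'$) such that (i) $L=L'\circ\Phi$; (ii) $\Phi(\mathcal M)\subset\mathcal M'$ and $\Phi|_{\mathcal M}:\mathcal M\to\mathcal M'$ is a surjective submersion; (iii) $\Phi(\mathcal V_a)=\mathcal V'_{\Phi(a)}$ for all $a\in\mathcal M$. Then $L'$ and $(L',\mathcal M')$ are regular, and $$\mathcal T^\Phi\Phi\circ\Gamma_{(L,\mathcal M)}=\Gamma_{(L',\mathcal M')}\circ\Phi\quad\text{on }\mathcal M,\qquad \mathcal T^\Phi\Phi(a,b,v)=(\Phi(a),\Phi(b),T_a\Phi(v)).$$ Moreover, if $t\mapsto a(t)$ is a solution of the Lagrange–d'Alembert differential equations for $(L,\mathcal M)$, then $t\mapsto\Phi(a(t))$ is a solution of those for $(L',\mathcal M')$. -/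

import Mathlib

open Bundle Manifold Set
open scoped Manifold ContDiff Topology

noncomputable section

/-! ### The algebraic exterior differential -/

/-- Koszul's formula for the exterior differential,
`dβ(σ₀,…,σ_p) = ∑ᵢ (-1)ⁱ ρ(σᵢ)(β(σ₀,…,σ̂ᵢ,…,σ_p))
  + ∑_{i<j} (-1)^{i+j} β([σᵢ,σⱼ],σ₀,…,σ̂ᵢ,…,σ̂ⱼ,…,σ_p)`.
Here `Sec` is a type of sections of the family `V`, `ev` evaluates a section at a point,
`der σ f` is the derivative of the function `f` along the anchor of `σ`, and `br` is the bracket.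
In the second sum the indices are `i.castSucc < j`, and `j.succAbove ∘ i.succAbove` enumerates the
remaining ones in increasing order. -/
def koszulDifferential {X Sec : Type*} {V : X → Type*} (ev : Sec → ∀ x, V x)
    (der : Sec → (X → ℝ) → X → ℝ) (br : Sec → Sec → ∀ x, V x) :
    (p : ℕ) → (∀ x, (Fin p → V x) → ℝ) → (Fin (p + 1) → Sec) → X → ℝ
  | 0, β, σ, x => der (σ 0) (fun y => β y Fin.elim0) x
  | q + 1, β, σ, x =>
      (∑ i : Fin (q + 2),
        (-1 : ℝ) ^ (i : ℕ) * der (σ i) (fun y => β y (fun k => ev (σ (i.succAbove k)) y)) x) +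
      ∑ j : Fin (q + 2), ∑ i : Fin (q + 1),
        if i.castSucc < j then
          (-1 : ℝ) ^ ((i : ℕ) + (j : ℕ)) *
            β x (Fin.cons (α := fun _ => V x) (br (σ i.castSucc) (σ j) x)
              (fun k => ev (σ (j.succAbove (i.succAbove k))) x))
        else 0

/-- The derivative `v f` of a real function `f` on a manifold along a tangent vector `v`. -/
def dirDeriv {V H P : Type*} [NormedAddCommGroup V] [NormedSpace ℝ V] [TopologicalSpace H]
    (I : ModelWithCorners ℝ V H) [TopologicalSpace P] [ChartedSpace H P]
    (f : P → ℝ) (x : P) (v : TangentSpace I x) : ℝ :=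
  mfderiv I 𝓘(ℝ, ℝ) f x v

/-! ### Lie algebroids -/

section Algebroid

variable {n : ℕ} {B : Type*} [TopologicalSpace B] [ChartedSpace (EuclideanSpace ℝ (Fin n)) B]
  {F : Type*} [NormedAddCommGroup F] [NormedSpace ℝ F]
  {E : B → Type*} [TopologicalSpace (TotalSpace F E)]
  [∀ x, AddCommGroup (E x)] [∀ x, Module ℝ (E x)] [∀ x, TopologicalSpace (E x)]
  [FiberBundle F E] [VectorBundle ℝ F E]

/-- The model with corners of the total space of a vector bundle with fibre `F` over an
`n`-dimensional manifold. -/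
abbrev totalModel (n : ℕ) (F : Type*) [NormedAddCommGroup F] [NormedSpace ℝ F] :
    ModelWithCorners ℝ (EuclideanSpace ℝ (Fin n) × F) (ModelProd (EuclideanSpace ℝ (Fin n)) F) :=
  (𝓡 n).prod 𝓘(ℝ, F)

/-- Smooth sections of the vector bundle `E`. -/
abbrev SmoothSec (n : ℕ) {B : Type*} [TopologicalSpace B]
    [ChartedSpace (EuclideanSpace ℝ (Fin n)) B]
    (F : Type*) [NormedAddCommGroup F] [NormedSpace ℝ F]
    (E : B → Type*) [TopologicalSpace (TotalSpace F E)]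
    [∀ x, TopologicalSpace (E x)] [FiberBundle F E] : Type _ :=
  ContMDiffSection (𝓡 n) F ∞ E

/-- The product `f σ` of a smooth function and a smooth section. -/
def smulSec [ContMDiffVectorBundle ∞ F E (𝓡 n)] (f : C^∞⟮𝓡 n, B; 𝓘(ℝ, ℝ), ℝ⟯)
    (σ : SmoothSec n F E) : SmoothSec n F E :=
  ⟨fun m => f m • σ m, f.contMDiff.smul_section σ.contMDiff⟩

variable (n F E) in
/-- A Lie algebroid structure on the vector bundle `E → B`: a smooth bundle map `ρ : E → TB` over
the identity (the anchor), and a Lie bracket on the smooth sections of `E` with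
`[σ, f η] = f [σ, η] + (ρ(σ) f) η`. -/
structure LieAlgebroid [IsManifold (𝓡 n) ∞ B] [ContMDiffVectorBundle ∞ F E (𝓡 n)] where
  /-- the anchor `ρ` -/
  anchor : ∀ m : B, E m →L[ℝ] TangentSpace (𝓡 n) m
  contMDiff_anchor : ContMDiff (totalModel n F) (𝓡 n).tangent ∞
    (fun a : TotalSpace F E => (⟨a.1, anchor a.1 a.2⟩ : TangentBundle (𝓡 n) B))
  /-- the bracket of smooth sections -/
  bracket : SmoothSec n F E → SmoothSec n F E → SmoothSec n F E
  bracket_add_right : ∀ σ η ξ, bracket σ (η + ξ) = bracket σ η + bracket σ ξ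
  bracket_smul_right : ∀ (c : ℝ) σ η, bracket σ (c • η) = c • bracket σ η
  bracket_skew : ∀ σ η, bracket σ η = - bracket η σ
  jacobi : ∀ σ η ξ,
    bracket σ (bracket η ξ) + bracket η (bracket ξ σ) + bracket ξ (bracket σ η) = 0
  leibniz : ∀ (σ η : SmoothSec n F E) (f : C^∞⟮𝓡 n, B; 𝓘(ℝ, ℝ), ℝ⟯) (m : B),
    bracket σ (smulSec f η) m =
      f m • bracket σ η m +
        dirDeriv (𝓡 n) f m (anchor m (σ m)) • η m

/-- The vertical lift `b_a^V ∈ T_a E`: the vector tangent to the curve `t ↦ a + t b` at `t = 0`. -/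
def verticalLift (a : TotalSpace F E) (b : E a.1) : TangentSpace (totalModel n F) a :=
  mfderiv 𝓘(ℝ, ℝ) (totalModel n F)
    (fun t : ℝ => (⟨a.1, a.2 + t • b⟩ : TotalSpace F E)) 0 (1 : ℝ)

/-- The vertical endomorphism `S(a, b, v) = (a, 0, b_a^V)`. -/
def verticalEndo (a : TotalSpace F E) (z : E a.1 × TangentSpace (totalModel n F) a) :
    E a.1 × TangentSpace (totalModel n F) a :=
  (0, verticalLift a z.1)

variable [IsManifold (𝓡 n) ∞ B] [ContMDiffVectorBundle ∞ F E (𝓡 n)]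

namespace LieAlgebroid

variable (A : LieAlgebroid n F E)

/-- The exterior differential of a `p`-form `β` of the Lie algebroid, evaluated on `p + 1` smooth
sections. -/
def extDiff {p : ℕ} (β : ∀ m : B, (E m) [⋀^Fin p]→ₗ[ℝ] ℝ) (σ : Fin (p + 1) → SmoothSec n F E)
    (m : B) : ℝ :=
  koszulDifferential (Sec := SmoothSec n F E) (V := E) (fun σ x => σ x)
    (fun σ f x => dirDeriv (𝓡 n) f x (A.anchor x (σ x)))
    (fun σ η x => A.bracket σ η x) p (fun x => β x) σ m

end LieAlgebroid

variable (n F) in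
/-- Smoothness of a `p`-form: its values on smooth sections are smooth functions. -/
def IsSmoothForm {p : ℕ} (β : ∀ m : B, (E m) [⋀^Fin p]→ₗ[ℝ] ℝ) : Prop :=
  ∀ σ : Fin p → SmoothSec n F E,
    ContMDiff (𝓡 n) 𝓘(ℝ, ℝ) ∞ (fun m => β m (fun i => σ i m))

namespace LieAlgebroid

variable (A : LieAlgebroid n F E)

/-! ### The prolongation of the Lie algebroid over itself -/

/-- The fibre `{(b, v) ∈ E_{τ(a)} × T_a E | ρ(b) = T_a τ (v)}` at `a ∈ E` of the prolongation of
`E` over `τ : E → B`. Its anchor is `(a, b, v) ↦ v`. -/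
def prol (a : TotalSpace F E) : Submodule ℝ (E a.1 × TangentSpace (totalModel n F) a) where
  carrier := {z | A.anchor a.1 z.1 = mfderiv (totalModel n F) (𝓡 n) (TotalSpace.proj) a z.2}
  zero_mem' := by
    change A.anchor a.1 0 = mfderiv (totalModel n F) (𝓡 n) (TotalSpace.proj) a 0
    rw [map_zero, map_zero]
  add_mem' := by
    intro z w hz hw
    change A.anchor a.1 z.1 = _ at hz
    change A.anchor a.1 w.1 = _ at hw
    change A.anchor a.1 (z + w).1 = mfderiv (totalModel n F) (𝓡 n) (TotalSpace.proj) a (z + w).2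
    rw [Prod.fst_add, Prod.snd_add, map_add, map_add, hz, hw]
  smul_mem' := by
    intro c z hz
    change A.anchor a.1 z.1 = _ at hz
    change A.anchor a.1 (c • z).1 = mfderiv (totalModel n F) (𝓡 n) (TotalSpace.proj) a (c • z).2
    rw [Prod.smul_fst, Prod.smul_snd, map_smul, map_smul, hz]

/-- A (smooth) projectable section `a ↦ (a, σ(τ(a)), X(a))` of the prolongation. -/
structure ProjectableSec where
  /-- the section `σ` of `E` -/
  base : SmoothSec n F E
  /-- the vector field `X` on `E` -/
  field : ∀ a : TotalSpace F E, TangentSpace (totalModel n F) a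
  contMDiff_field : ContMDiff (totalModel n F) (totalModel n F).tangent ∞
    (fun a => (⟨a, field a⟩ : TangentBundle (totalModel n F) (TotalSpace F E)))
  mem_prol : ∀ a, (base a.1, field a) ∈ A.prol a

theorem verticalEndo_mem_prol (a : TotalSpace F E)
    (z : E a.1 × TangentSpace (totalModel n F) a) : verticalEndo a z ∈ A.prol a := by
  change A.anchor a.1 0 = mfderiv (totalModel n F) (𝓡 n) TotalSpace.proj a (verticalLift a z.1)
  rw [map_zero]
  set c : ℝ → TotalSpace F E := fun t => ⟨a.1, a.2 + t • z.1⟩ with hc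
  by_cases h : MDifferentiableAt 𝓘(ℝ, ℝ) (totalModel n F) c 0
  · have h0 : c 0 = a := by simp [hc]
    have hp : MDifferentiableAt (totalModel n F) (𝓡 n) (TotalSpace.proj : TotalSpace F E → B) (c 0) :=
      ((contMDiff_proj (IB := 𝓡 n) (n := ∞) E) (c 0)).mdifferentiableAt (by simp)
    have h1 := mfderiv_comp (0 : ℝ) hp h
    have h2 : (TotalSpace.proj : TotalSpace F E → B) ∘ c = fun _ => a.1 := rfl
    rw [h2, mfderiv_const] at h1
    have h3 := congrArg (fun T => T (1 : ℝ)) h1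
    rw [h0] at h3
    exact h3
  · have : verticalLift (n := n) a z.1 = 0 := by
      unfold verticalLift
      rw [mfderiv_zero_of_not_mdifferentiableAt h]
      rfl
    rw [this, map_zero]

theorem exists_projectableSec [T2Space B] [FiniteDimensional ℝ F] (a : TotalSpace F E)
    (z : A.prol a) : ∃ Z : A.ProjectableSec, (Z.base a.1, Z.field a) = z.1 := by
  let e := trivializationAt F E a.1
  have ha : a.1 ∈ e.baseSet := FiberBundle.mem_baseSet_trivializationAt' a.1
  obtain ⟨χ, hχ⟩ : ∃ χ : SmoothBumpFunction (𝓡 n) a.1, tsupport χ ⊆ e.baseSet := by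
    have := SmoothBumpFunction.nhds_basis_tsupport (I := 𝓡 n) a.1
    obtain ⟨χ, h1, h2⟩ := this.mem_iff.1 (e.open_baseSet.mem_nhds ha)
    exact ⟨χ, h2⟩
  have hχ1 : χ a.1 = 1 := χ.eq_one
  let s : ∀ m, E m := FiberBundle.extend F z.1.1
  have hs : ContMDiffOn (𝓡 n) (totalModel n F) ∞ (fun m => (⟨m, s m⟩ : TotalSpace F E)) e.baseSet := by
    intro x hx
    rw [e.contMDiffWithinAt_section _ hx]
    have : ContMDiffOn (𝓡 n) 𝓘(ℝ, F) ∞ (fun _ : B => (e ⟨a.1, z.1.1⟩).2) e.baseSet :=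
      contMDiffOn_const
    exact (this.congr (fun x hx => by simp [FiberBundle.extend, s, e, hx])) x hx
  have hsa : s a.1 = z.1.1 := FiberBundle.extend_apply_self F z.1.1
  let c : F := (mfderiv (totalModel n F) (totalModel n F) e a z.1.2 : EuclideanSpace ℝ (Fin n) × F).2
  let V : ∀ p : B × F, TangentSpace (totalModel n F) p := fun p => (A.anchor p.1 (s p.1), c)
  have hV : ContMDiffOn (totalModel n F) (totalModel n F).tangent ∞
      (fun p => (⟨p, V p⟩ : TangentBundle (totalModel n F) (B × F))) (e.baseSet ×ˢ univ) := by
    have h1 : ContMDiffOn (totalModel n F) (𝓡 n).tangent ∞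
      (fun p : B × F => (⟨p.1, A.anchor p.1 (s p.1)⟩ : TangentBundle (𝓡 n) B)) (e.baseSet ×ˢ univ) :=
      A.contMDiff_anchor.comp_contMDiffOn (hs.comp contMDiffOn_fst (fun p hp => hp.1))
    have h2 : ContMDiffOn (totalModel n F) (𝓘(ℝ, F)).tangent ∞
      (fun p : B × F => (⟨p.2, c⟩ : TangentBundle 𝓘(ℝ, F) F)) (e.baseSet ×ˢ univ) := by
      have h3 : ContMDiff 𝓘(ℝ, F) (𝓘(ℝ, F)).tangent ∞
          (fun q : F => (⟨q, c⟩ : TangentBundle 𝓘(ℝ, F) F)) :=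
        (contMDiff_vectorSpace_iff_contDiff (V := fun _ => c)).2 contDiff_const
      exact (h3.comp contMDiff_snd).contMDiffOn
    exact (contMDiff_equivTangentBundleProd_symm (I := 𝓡 n) (M := B) (I' := 𝓘(ℝ, F)) (M' := F)).comp_contMDiffOn
      (h1.prodMk h2)
  have he : e.toOpenPartialHomeomorph.MDifferentiable (totalModel n F) (totalModel n F) :=
    ⟨(e.contMDiffOn (IB := 𝓡 n) (n := ∞)).mdifferentiableOn (by simp),
      (e.contMDiffOn_symm (IB := 𝓡 n) (n := ∞)).mdifferentiableOn (by simp)⟩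
  have hinv : ∀ y ∈ e.source, (mfderiv (totalModel n F) (totalModel n F) e y).IsInvertible := 
    fun y hy => ⟨he.mfderiv hy, rfl⟩
  let X : ∀ y : TotalSpace F E, TangentSpace (totalModel n F) y :=
    VectorField.mpullback (totalModel n F) (totalModel n F) e V
  have hX : ContMDiffOn (totalModel n F) (totalModel n F).tangent ∞
      (fun y => (⟨y, X y⟩ : TangentBundle (totalModel n F) (TotalSpace F E))) e.source := by
    intro y hy
    have hy1 : e y ∈ e.baseSet ×ˢ (univ : Set F) := by
      rw [← e.target_eq]; exact e.map_source hy
    refine (ContMDiffAt.mpullback_vectorField_preimage (n := ∞)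
      ((hV _ hy1).contMDiffAt ((e.open_baseSet.prod isOpen_univ).mem_nhds hy1))
      ((e.contMDiffOn (IB := 𝓡 n) (n := ∞) y hy).contMDiffAt (e.open_source.mem_nhds hy))
      (hinv y hy) (by simp)).contMDiffWithinAt
  have hproj : ∀ y ∈ e.source, ∀ v, 
      mfderiv (totalModel n F) (𝓡 n) TotalSpace.proj y v =
       (mfderiv (totalModel n F) (totalModel n F) e y v : EuclideanSpace ℝ (Fin n) × F).1 := by
    intro y hy v
    have hd := (he.mdifferentiableAt hy)
    have h1 : HasMFDerivAt (totalModel n F) (𝓡 n) (Prod.fst ∘ e) y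
        ((ContinuousLinearMap.fst ℝ (EuclideanSpace ℝ (Fin n)) F).comp
          (mfderiv (totalModel n F) (totalModel n F) e y)) :=
      HasMFDerivAt.comp y (hasMFDerivAt_fst (I := 𝓡 n) (I' := 𝓘(ℝ, F)) (e y)) hd.hasMFDerivAt
    have h2 : (TotalSpace.proj : TotalSpace F E → B) =ᶠ[𝓝 y] (Prod.fst ∘ e) := by
      filter_upwards [e.open_source.mem_nhds hy] with x hx
      exact (e.coe_fst hx).symm
    rw [h2.mfderiv_eq, h1.mfderiv]
    rfl
  have hXproj : ∀ y ∈ e.source, A.anchor y.1 (s y.1) =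
      mfderiv (totalModel n F) (𝓡 n) TotalSpace.proj y (X y) := by
    intro y hy
    rw [hproj y hy]
    have : mfderiv (totalModel n F) (totalModel n F) e y (X y) = V (e y) := by
      obtain ⟨T, hT⟩ := hinv y hy
      change mfderiv (totalModel n F) (totalModel n F) e y
        ((mfderiv (totalModel n F) (totalModel n F) e y).inverse (V (e y))) = _
      rw [← hT, ContinuousLinearMap.inverse_equiv]
      exact T.apply_symm_apply _
    rw [this]
    have hy' : (e y).1 = y.1 := e.coe_fst hy
    change A.anchor y.1 (s y.1) = A.anchor (e y).1 (s (e y).1)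
    rw [hy']
  have has : a ∈ e.source := e.mem_source.2 ha
  have hXa : X a = z.1.2 := by
    have hza := z.2
    change A.anchor a.1 z.1.1 = _ at hza
    have h1 : V (e a) = mfderiv (totalModel n F) (totalModel n F) e a z.1.2 := by
      refine Prod.ext ?_ rfl
      rw [← hproj a has, ← hza, ← hsa]
      have hy' : (e a).1 = a.1 := e.coe_fst has
      change A.anchor (e a).1 (s (e a).1) = _
      rw [hy']
    obtain ⟨T, hT⟩ := hinv a has
    change (mfderiv (totalModel n F) (totalModel n F) e a).inverse (V (e a)) = _
    rw [h1, ← hT, ContinuousLinearMap.inverse_equiv]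
    exact T.symm_apply_apply _
  refine ⟨⟨⟨fun m => χ m • s m, ?_⟩, fun y => χ y.1 • X y, ?_, ?_⟩, ?_⟩
  · exact ContMDiffOn.smul_section_of_tsupport (ψ := χ) χ.contMDiff.contMDiffOn e.open_baseSet hχ hs
  · refine ContMDiffOn.smul_section_of_tsupport (ψ := fun y : TotalSpace F E => χ y.1) 
      (χ.contMDiff.comp (contMDiff_proj E)).contMDiffOn e.open_source ?_ hX
    intro y hy
    refine e.mem_source.2 (hχ ?_)
    have hcl : tsupport (fun y : TotalSpace F E => χ y.1) ⊆ TotalSpace.proj ⁻¹' tsupport χ :=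
      closure_minimal (fun x hx => subset_tsupport χ hx)
        ((isClosed_tsupport χ).preimage (FiberBundle.continuous_proj F E))
    exact hcl hy
  · intro y
    change A.anchor y.1 (χ y.1 • s y.1) =  mfderiv (totalModel n F) (𝓡 n) TotalSpace.proj y (χ y.1 • X y)
    rw [map_smul, map_smul]
    by_cases hy : y ∈ e.source
    · rw [hXproj y hy]
    · have : χ y.1 = 0 := by
        by_contra h
        exact hy (e.mem_source.2 (hχ (subset_tsupport _ h)))
      rw [this, zero_smul, zero_smul]
  · change (χ a.1 • s a.1, χ a.1 • X a) = z.1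
    rw [hχ1, one_smul, one_smul, hsa, hXa]

/-! ### Forms on the prolongation and the Cartan forms -/

/-- The exterior differential of a `p`-form `β` on the prolongation, evaluated on `p + 1` projectable
sections. The anchor of `(σ, X)` is `X`, and the bracket of projectable sections is
`[(σ₁, X₁), (σ₂, X₂)] = ([σ₁, σ₂], [X₁, X₂])`. -/
def prolExtDiff {p : ℕ}
    (β : ∀ a : TotalSpace F E, (Fin p → E a.1 × TangentSpace (totalModel n F) a) → ℝ)
    (Z : Fin (p + 1) → A.ProjectableSec) (a : TotalSpace F E) : ℝ :=
  koszulDifferential (Sec := A.ProjectableSec)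
    (V := fun a : TotalSpace F E => E a.1 × TangentSpace (totalModel n F) a)
    (fun Z a => (Z.base a.1, Z.field a))
    (fun Z f a => dirDeriv (totalModel n F) f a (Z.field a))
    (fun Z W a => (A.bracket Z.base W.base a.1,
      VectorField.mlieBracket (totalModel n F) Z.field W.field a))
    p β Z a

/-- A projectable section through a given element of the prolongation. -/
def extend [T2Space B] [FiniteDimensional ℝ F] {a : TotalSpace F E} (z : A.prol a) :
    A.ProjectableSec :=
  (A.exists_projectableSec a z).choose

end LieAlgebroid

/-- The Cartan 1-form `θ_L = S^*(dL)`, i.e. `θ_L(z) = dL(S z) = ρ¹(S z) L`. -/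
def cartanOneForm (L : TotalSpace F E → ℝ) (a : TotalSpace F E)
    (z : E a.1 × TangentSpace (totalModel n F) a) : ℝ :=
  dirDeriv (totalModel n F) L a (verticalEndo a z).2

variable (n) in
/-- The energy `E_L = d_Δ L - L`, where `Δ(a) = (a, 0, a_a^V)` is the Liouville section. -/
def energy (L : TotalSpace F E → ℝ) (a : TotalSpace F E) : ℝ :=
  dirDeriv (totalModel n F) L a (verticalLift a a.2) - L a

namespace LieAlgebroid

variable (A : LieAlgebroid n F E)

/-- The Cartan 2-form `ω_L = -dθ_L` on the fibre of the prolongation at `a`. Since `dθ_L` is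
tensorial, its value on two elements is computed on projectable sections through them. -/
def cartanTwoForm [T2Space B] [FiniteDimensional ℝ F] (L : TotalSpace F E → ℝ)
    (a : TotalSpace F E) (z w : A.prol a) : ℝ :=
  - A.prolExtDiff (p := 1) (fun a z => cartanOneForm L a (z 0)) ![A.extend z, A.extend w] a

/-- The differential `dE_L` of the energy, as a 1-form on the prolongation. -/
def dEnergy (L : TotalSpace F E → ℝ) (a : TotalSpace F E) (w : A.prol a) : ℝ :=
  dirDeriv (totalModel n F) (energy n L) a w.1.2

/-- The Lagrangian `L` is regular: `ω_L` is nondegenerate at every point. -/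
def IsRegularLagrangian [T2Space B] [FiniteDimensional ℝ F] (L : TotalSpace F E → ℝ) : Prop :=
  ∀ (a : TotalSpace F E) (z : A.prol a), (∀ w : A.prol a, A.cartanTwoForm L a z w = 0) → z = 0

end LieAlgebroid

/-! ### Constraints and the Lagrange-d'Alembert equations -/

section Constraints

variable {k : ℕ} {N : Type*} [TopologicalSpace N] [ChartedSpace (EuclideanSpace ℝ (Fin k)) N]

variable (n k) in
/-- The image of `ι : N → E` is an (embedded) submanifold of `E` on which `τ` is a surjective
submersion onto `B`. -/
structure IsConstraintSubmanifold (ι : N → TotalSpace F E) : Prop where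
  isSmoothEmbedding : IsSmoothEmbedding (𝓡 k) (totalModel n F) ∞ ι
  surjective_proj : Function.Surjective (fun p => (ι p).1)
  isSubmersion_proj : IsSubmersion (𝓡 k) (𝓡 n) ∞ (fun p => (ι p).1)

variable (k) in
/-- The tangent space of the submanifold `ι(N) ⊆ E` at `ι(p)`, as a subspace of `T_{ι(p)} E`. -/
def constraintTangent (ι : N → TotalSpace F E) (p : N) :
    Submodule ℝ (TangentSpace (totalModel n F) (ι p)) :=
  LinearMap.range (mfderiv (𝓡 k) (totalModel n F) ι p).toLinearMap

variable (n k) in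
/-- The virtual displacements at `a = ι(p)`: the elements `b` of the fibre `E_{τ(a)}` with `b_a^V`
tangent to the constraint submanifold, regarded as a subset of the total space. -/
def virtualDisplacements (ι : N → TotalSpace F E) (p : N) : Set (TotalSpace F E) :=
  {c | ∃ b : E (ι p).1, c = ⟨(ι p).1, b⟩ ∧
    verticalLift (ι p) b ∈ constraintTangent (n := n) k ι p}

namespace LieAlgebroid

variable (A : LieAlgebroid n F E)

variable (k) in
/-- The constraint forces `S^*((T^E N)°)` at `a = ι(p)`, where `(T^E N)°` is the annihilator of
the subspace `{(b, v) | v ∈ T_a N}` of the fibre of the prolongation at `a`. -/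
def constraintForces (ι : N → TotalSpace F E) (p : N) : Set (A.prol (ι p) → ℝ) :=
  {f | ∃ α : Module.Dual ℝ (A.prol (ι p)),
    (∀ w : A.prol (ι p), w.1.2 ∈ constraintTangent k ι p → α w = 0) ∧
    ∀ w : A.prol (ι p), f w = α ⟨verticalEndo (ι p) w.1, A.verticalEndo_mem_prol (ι p) w.1⟩}

variable (k) in
/-- A smooth section of `T^E N → N`: a smooth section along `ι` of the prolongation of `E` over `E`
whose anchor image is tangent to `N`. -/
structure ConstrainedSec (ι : N → TotalSpace F E) where
  /-- the value at `ι(p)` -/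
  val : ∀ p : N, A.prol (ι p)
  tangent : ∀ p, (val p).1.2 ∈ constraintTangent k ι p
  contMDiff_fst : ContMDiff (𝓡 k) (totalModel n F) ∞
    (fun p => (⟨(ι p).1, (val p).1.1⟩ : TotalSpace F E))
  contMDiff_snd : ContMDiff (𝓡 k) (totalModel n F).tangent ∞
    (fun p => (⟨ι p, (val p).1.2⟩ : TangentBundle (totalModel n F) (TotalSpace F E)))

variable {A}

/-- The Lagrange-d'Alembert equations: `i_Γ ω_L - dE_L` is a constraint force at every point of the
constraint submanifold. -/
def ConstrainedSec.IsSolution [T2Space B] [FiniteDimensional ℝ F] {ι : N → TotalSpace F E}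
    (Γ : A.ConstrainedSec k ι) (L : TotalSpace F E → ℝ) : Prop :=
  ∀ p : N, (fun w : A.prol (ι p) => A.cartanTwoForm L (ι p) (Γ.val p) w - A.dEnergy L (ι p) w) ∈
    A.constraintForces k ι p

variable (A k) in
/-- The constrained Lagrangian system `(L, ι(N))` is regular: the Lagrange-d'Alembert equations have
a unique solution. -/
def IsRegularConstrained [T2Space B] [FiniteDimensional ℝ F] (L : TotalSpace F E → ℝ)
    (ι : N → TotalSpace F E) : Prop :=
  ∃! Γ : A.ConstrainedSec k ι, Γ.IsSolution L

/-- On the set of times `s` (for instance an interval), `c` is a solution of the Lagrange-d'Alembert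
differential equations, i.e. an integral curve of the vector field `ρ¹(Γ)` on the constraint
submanifold: it lies in the submanifold and its velocity at time `t` is `ρ¹(Γ(c(t)))`. -/
def ConstrainedSec.IsTrajectory {ι : N → TotalSpace F E} (Γ : A.ConstrainedSec k ι)
    (s : Set ℝ) (c : ℝ → TotalSpace F E) : Prop :=
  ∃ q : ℝ → N, (∀ t ∈ s, c t = ι (q t)) ∧
    ∀ t ∈ s, HasMFDerivWithinAt 𝓘(ℝ, ℝ) (totalModel n F) (fun u => ι (q u)) s t
      ((1 : ℝ →L[ℝ] ℝ).smulRight (Γ.val (q t)).1.2)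

end LieAlgebroid
end Constraints

/-! ### Morphisms -/

section Morphisms

variable {n' : ℕ} {B' : Type*} [TopologicalSpace B'] [ChartedSpace (EuclideanSpace ℝ (Fin n')) B']
  {F' : Type*} [NormedAddCommGroup F'] [NormedSpace ℝ F']
  {E' : B' → Type*} [TopologicalSpace (TotalSpace F' E')]
  [∀ x, AddCommGroup (E' x)] [∀ x, Module ℝ (E' x)] [∀ x, TopologicalSpace (E' x)]
  [FiberBundle F' E'] [VectorBundle ℝ F' E']
  [IsManifold (𝓡 n') ∞ B'] [ContMDiffVectorBundle ∞ F' E' (𝓡 n')]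

variable (n F E n' F' E') in
/-- A smooth vector bundle map `Φ : E → E'` over a map `base : B → B'`. -/
structure SmoothBundleMap where
  /-- the base map -/
  base : B → B'
  /-- the map on fibres -/
  fib : ∀ m : B, E m →L[ℝ] E' (base m)
  contMDiff_total : ContMDiff (totalModel n F) (totalModel n' F') ∞
    (fun a : TotalSpace F E => (⟨base a.1, fib a.1 a.2⟩ : TotalSpace F' E'))

namespace SmoothBundleMap

variable (Φ : SmoothBundleMap n F E n' F' E')

/-- The map on total spaces. -/
def total (a : TotalSpace F E) : TotalSpace F' E' := ⟨Φ.base a.1, Φ.fib a.1 a.2⟩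

/-- The pullback `Φ^⋆ β` of a `p`-form. -/
def pullback {p : ℕ} (β : ∀ m : B', (E' m) [⋀^Fin p]→ₗ[ℝ] ℝ) (m : B) :
    (E m) [⋀^Fin p]→ₗ[ℝ] ℝ :=
  (β (Φ.base m)).compLinearMap (Φ.fib m).toLinearMap

/-- `Φ` is a morphism of Lie algebroids: `Φ^⋆ dβ = dΦ^⋆ β` for every smooth form `β` on `E'`. The
value of `dβ` on `Φ(σ₀(m)), …, Φ(σ_p(m))` is computed on sections `σ'ᵢ` of `E'` through
these vectors. -/
def IsMorphism (A : LieAlgebroid n F E) (A' : LieAlgebroid n' F' E') : Prop :=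
  ∀ (p : ℕ) (β : ∀ m : B', (E' m) [⋀^Fin p]→ₗ[ℝ] ℝ), IsSmoothForm n' F' β →
    ∀ (σ : Fin (p + 1) → SmoothSec n F E) (σ' : Fin (p + 1) → SmoothSec n' F' E') (m : B),
      (∀ i, σ' i (Φ.base m) = Φ.fib m (σ i m)) →
        A'.extDiff β σ' (Φ.base m) = A.extDiff (Φ.pullback β) σ m

/-- The prolongation `(a, b, v) ↦ (Φ(a), Φ(b), TΦ(v))` of `Φ` along itself. -/
def prolMap (z : Σ a : TotalSpace F E, E a.1 × TangentSpace (totalModel n F) a) :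
    Σ a : TotalSpace F' E', E' a.1 × TangentSpace (totalModel n' F') a :=
  ⟨Φ.total z.1, (Φ.fib z.1.1 z.2.1, mfderiv (totalModel n F) (totalModel n' F') Φ.total z.1 z.2.2)⟩

end SmoothBundleMap
end Morphisms
end Algebroid
end

/-! The heart of the matter is that `ω_L` and `dE_L` are the pullbacks of `ω_{L'}` and `dE_{L'}` by
the prolongation `T^ΦΦ` (`cartanTwoForm_eq`, `dEnergy_eq`). In a local frame `eᵢ` of `E'` with dual
coframe `βᵢ`, the Cartan 1-form is `θ_{L'} = ∑ᵢ FL'(eᵢ) βᵢ`, where `FL'` is the fibre derivative.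
Its differential involves only derivatives of functions and the `dβᵢ`, so the morphism property is
needed only for forms of degree 0 and 1.

Fibrewise surjectivity of `Φ` makes `T^ΦΦ` fibrewise surjective, so nondegeneracy passes from `ω_L`
to `ω_{L'}`. An element of the kernel of `T^ΦΦ` lies in the kernel of `ω_L`, so regularity of `L`
makes `T^ΦΦ`, and with it `Φ`, injective on fibres.

A form on a fibre of the prolongation lies in `S^*((T^E N)°)` iff it kills all `(b, v)` with `b` a
virtual displacement (`mem_constraintForces_iff_solvesAt`). By (iii) these test elements correspond
under `T^ΦΦ`, so an element solves the equations at a point iff its image does (`solvesAt_iff`).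
Elements tangent to `N'` lift to elements tangent to `N`: a first lift is corrected by a vertical
vector supplied by (iii) (`exists_lift`). Thus a solution `Γ'` lifts pointwise to `N`, and the lift
is smooth because its image `Γ' ∘ ψ` is smooth and `Φ` is fibrewise injective
(`contMDiffAt_of_prolMap`). By uniqueness the lift is `Γ`, which gives both uniqueness of `Γ'` and
the relation between the dynamics.

Existence of `Γ'` requires that `T^ΦΦ ∘ Γ` be constant on the fibres of `ψ`
(`prolMap_eq_of_unique`). Uniqueness of `Γ` is assumed only for global smooth sections, so it is
exploited by deformation. Pointwise solutions form an affine space, and the values of `Γ` along a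
local section of `ψ` through `p₁` can be transported to all points over its domain. Blending this
transported solution with `Γ` by a bump function pulled back from `N'` gives a global solution,
which must be `Γ`. Smoothness of the descended section then follows from local sections of `ψ`. -/

set_option linter.unusedSectionVars false

noncomputable section

/-! ### Smoothness of sections along maps, and of lifts through injective bundle maps. -/

section BundleMaps

variable {EM HM M : Type*} [NormedAddCommGroup EM] [NormedSpace ℝ EM] [TopologicalSpace HM]
  {IM : ModelWithCorners ℝ EM HM} [TopologicalSpace M] [ChartedSpace HM M]
  {EB HB B : Type*} [NormedAddCommGroup EB] [NormedSpace ℝ EB] [TopologicalSpace HB]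
  {IB : ModelWithCorners ℝ EB HB} [TopologicalSpace B] [ChartedSpace HB B]
  {F : Type*} [NormedAddCommGroup F] [NormedSpace ℝ F]
  {E : B → Type*} [TopologicalSpace (TotalSpace F E)]
  [∀ x, AddCommGroup (E x)] [∀ x, Module ℝ (E x)] [∀ x, TopologicalSpace (E x)]
  [FiberBundle F E] [VectorBundle ℝ F E]

/-- Linear combinations of sections along a map are smooth. -/
theorem contMDiffAt_add_smul_along {k : ℕ∞ω} {f : M → B} {s t : ∀ x, E (f x)} {c : M → ℝ} {x₀ : M}
    (hs : ContMDiffAt IM (IB.prod 𝓘(ℝ, F)) k (fun x => (⟨f x, s x⟩ : TotalSpace F E)) x₀)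
    (ht : ContMDiffAt IM (IB.prod 𝓘(ℝ, F)) k (fun x => (⟨f x, t x⟩ : TotalSpace F E)) x₀)
    (hc : ContMDiffAt IM 𝓘(ℝ, ℝ) k c x₀) :
    ContMDiffAt IM (IB.prod 𝓘(ℝ, F)) k
      (fun x => (⟨f x, s x + c x • t x⟩ : TotalSpace F E)) x₀ := by
  rw [contMDiffAt_totalSpace] at hs ht ⊢
  refine ⟨hs.1, ?_⟩
  set e := trivializationAt F E (f x₀)
  have hf : ∀ᶠ x in 𝓝 x₀, f x ∈ e.baseSet :=
    hs.1.continuousAt.eventually (e.open_baseSet.mem_nhds (mem_baseSet_trivializationAt F E _))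
  refine (hs.2.add (hc.smul ht.2)).congr_of_eventuallyEq ?_
  filter_upwards [hf] with x hx
  have hl := e.linear ℝ hx
  change (e ⟨f x, s x + c x • t x⟩).2 = (e ⟨f x, s x⟩).2 + c x • (e ⟨f x, t x⟩).2
  rw [hl.map_add, hl.map_smul]

/-- In a finite basis `bᵢ` with coordinate forms `ℓᵢ`, an operator is `∑ᵢ ℓᵢ ⊗ T(bᵢ)`, a fixed
continuous linear function of its finitely many values on the basis. -/
theorem contMDiffAt_clm_of_apply {V W : Type*} [NormedAddCommGroup V] [NormedSpace ℝ V]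
    [FiniteDimensional ℝ V] [NormedAddCommGroup W] [NormedSpace ℝ W] {k : ℕ∞ω}
    {T : M → V →L[ℝ] W} {x₀ : M} (hT : ∀ v, ContMDiffAt IM 𝓘(ℝ, W) k (fun x => T x v) x₀) :
    ContMDiffAt IM 𝓘(ℝ, V →L[ℝ] W) k T x₀ := by
  let b := Module.finBasis ℝ V
  let ℓ : Fin (Module.finrank ℝ V) → V →L[ℝ] ℝ := fun i => LinearMap.toContinuousLinearMap (b.coord i)
  have h : T = fun x => ∑ i, (ContinuousLinearMap.smulRightL ℝ V W (ℓ i)) (T x (b i)) := by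
    funext x
    ext v
    rw [sum_apply]
    conv_lhs => rw [← b.sum_repr v, map_sum]
    refine Finset.sum_congr rfl fun i _ => ?_
    rw [map_smul]
    rfl
  rw [h]
  refine contMDiffAt_finsetSum fun i _ => ?_
  exact ((ContinuousLinearMap.smulRightL ℝ V W (ℓ i)).contMDiff).contMDiffAt.comp x₀ (hT (b i))

variable {EB' HB' B' : Type*} [NormedAddCommGroup EB'] [NormedSpace ℝ EB'] [TopologicalSpace HB']
  {IB' : ModelWithCorners ℝ EB' HB'} [TopologicalSpace B'] [ChartedSpace HB' B']
  {F' : Type*} [NormedAddCommGroup F'] [NormedSpace ℝ F']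
  {E' : B' → Type*} [TopologicalSpace (TotalSpace F' E')]
  [∀ x, AddCommGroup (E' x)] [∀ x, Module ℝ (E' x)] [∀ x, TopologicalSpace (E' x)]
  [FiberBundle F' E'] [VectorBundle ℝ F' E']

/-- If a smooth vector bundle map `G` is injective on the fibre over `f x₀` and `s` is a section
along `f` such that `G ∘ s` is smooth at `x₀`, then `s` is smooth at `x₀`. -/
theorem contMDiffAt_of_injective_bundleMap [FiniteDimensional ℝ F] [FiniteDimensional ℝ F']
    {k : ℕ∞ω} [ContMDiffVectorBundle k F E IB] [ContMDiffVectorBundle k F' E' IB']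
    {g : B → B'} (G : ∀ m, E m →L[ℝ] E' (g m))
    (hG : ContMDiff (IB.prod 𝓘(ℝ, F)) (IB'.prod 𝓘(ℝ, F')) k
      (fun a : TotalSpace F E => (⟨g a.1, G a.1 a.2⟩ : TotalSpace F' E')))
    {f : M → B} {s : ∀ x, E (f x)} {x₀ : M} (hf : ContMDiffAt IM IB k f x₀)
    (hinj : Function.Injective (G (f x₀)))
    (hs : ContMDiffAt IM (IB'.prod 𝓘(ℝ, F')) k
      (fun x => (⟨g (f x), G (f x) (s x)⟩ : TotalSpace F' E')) x₀) :
    ContMDiffAt IM (IB.prod 𝓘(ℝ, F)) k (fun x => (⟨f x, s x⟩ : TotalSpace F E)) x₀ := by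
  rw [contMDiffAt_totalSpace] at hs ⊢
  refine ⟨hf, ?_⟩
  set e := trivializationAt F E (f x₀)
  set e' := trivializationAt F' E' (g (f x₀))
  have hfe : ∀ᶠ x in 𝓝 x₀, f x ∈ e.baseSet :=
    hf.continuousAt.eventually (e.open_baseSet.mem_nhds (mem_baseSet_trivializationAt F E _))
  have hfe' : ∀ᶠ x in 𝓝 x₀, g (f x) ∈ e'.baseSet :=
    hs.1.continuousAt.eventually (e'.open_baseSet.mem_nhds (mem_baseSet_trivializationAt F' E' _))
  let T : M → F →L[ℝ] F' := fun x =>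
    (e'.continuousLinearMapAt ℝ (g (f x))).comp ((G (f x)).comp (e.symmL ℝ (f x)))
  have hTapp : ∀ x, f x ∈ e.baseSet → g (f x) ∈ e'.baseSet → ∀ y,
      T x y = (e' ⟨g (f x), G (f x) (e.symm (f x) y)⟩).2 := by
    intro x hx hx' y
    change e'.continuousLinearMapAt ℝ (g (f x)) (G (f x) (e.symmL ℝ (f x) y)) = _
    rw [e'.continuousLinearMapAt_apply (R := ℝ), e'.coe_linearMapAt_of_mem (R := ℝ) hx']
    rw [e.symmL_apply hx]
  have hT : ContMDiffAt IM 𝓘(ℝ, F →L[ℝ] F') k T x₀ := by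
    refine contMDiffAt_clm_of_apply fun y => ?_
    have h1 : ContMDiffAt IM (IB.prod 𝓘(ℝ, F)) k
        (fun x => (⟨f x, e.symm (f x) y⟩ : TotalSpace F E)) x₀ := by
      rw [contMDiffAt_totalSpace]
      refine ⟨hf, (contMDiffAt_const (c := y)).congr_of_eventuallyEq ?_⟩
      filter_upwards [hfe] with x hx
      change (e ⟨f x, e.symm (f x) y⟩).2 = y
      rw [e.apply_mk_symm hx]
    have h2 := (hG _).comp x₀ h1
    have h3 := (contMDiffAt_totalSpace.1 h2).2
    refine h3.congr_of_eventuallyEq ?_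
    filter_upwards [hfe, hfe'] with x hx hx'
    exact hTapp x hx hx' y
  have hx₀ := hfe.self_of_nhds
  have hx₀' := hfe'.self_of_nhds
  have hTinj : Function.Injective (T x₀) := by
    intro y z hyz
    rw [hTapp x₀ hx₀ hx₀', hTapp x₀ hx₀ hx₀'] at hyz
    have h1 := (e'.continuousLinearEquivAt ℝ _ hx₀').injective hyz
    have h2 := hinj h1
    exact (e.continuousLinearEquivAt ℝ _ hx₀).symm.injective h2
  -- A left inverse `P` of the local expression `T` at `x₀` alone suffices: `Q = P ∘ T` is the
  -- identity at `x₀`, hence invertible nearby with smooth inverse, and the section is recovered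
  -- there as `Q⁻¹ P (G s)`.
  obtain ⟨P₀, hP₀⟩ := (T x₀).toLinearMap.exists_leftInverse_of_injective
    (LinearMap.ker_eq_bot.2 hTinj)
  let P : F' →L[ℝ] F := LinearMap.toContinuousLinearMap P₀
  have hPT : P.comp (T x₀) = (ContinuousLinearEquiv.refl ℝ F : F →L[ℝ] F) := by
    ext y
    exact LinearMap.congr_fun hP₀ y
  let Q : M → F →L[ℝ] F := fun x => P.comp (T x)
  have hQ : ContMDiffAt IM 𝓘(ℝ, F →L[ℝ] F) k Q x₀ := contMDiffAt_const.clm_comp hT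
  have hQ₀ : Q x₀ = (ContinuousLinearEquiv.refl ℝ F : F →L[ℝ] F) := hPT
  have hQinv : ContMDiffAt IM 𝓘(ℝ, F →L[ℝ] F) k (fun x => (Q x).inverse) x₀ := by
    have h1 : ContDiffAt ℝ k (ContinuousLinearMap.inverse (R := ℝ) (M := F) (M₂ := F)) (Q x₀) := by
      rw [hQ₀]; exact contDiffAt_map_inverse _
    exact h1.contMDiffAt.comp x₀ hQ
  have hev : ∀ᶠ x in 𝓝 x₀, Q x ∈ range (ContinuousLinearEquiv.toContinuousLinearMap (σ₁₂ := RingHom.id ℝ) (M₁ := F) (M₂ := F)) := by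
    refine hQ.continuousAt.eventually ?_
    rw [hQ₀]; exact ContinuousLinearEquiv.nhds _
  have hP : ContMDiffAt IM 𝓘(ℝ, F) k
      (fun x => P (e' ⟨g (f x), G (f x) (s x)⟩).2) x₀ :=
    P.contMDiff.contMDiffAt.comp x₀ hs.2
  refine (hQinv.clm_apply hP).congr_of_eventuallyEq ?_
  filter_upwards [hfe, hfe', hev] with x hx hx' ⟨R, hR⟩
  have h1 : (e' ⟨g (f x), G (f x) (s x)⟩).2 = T x (e ⟨f x, s x⟩).2 := by
    rw [hTapp x hx hx', e.symm_apply_apply_mk hx]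
  rw [h1]
  change _ = (Q x).inverse (Q x (e ⟨f x, s x⟩).2)
  rw [← hR, ContinuousLinearMap.inverse_equiv]
  exact (R.symm_apply_apply _).symm

end BundleMaps

/-! ### Local sections of submersions. -/

section Submersions

variable {EM HM M : Type*} [NormedAddCommGroup EM] [NormedSpace ℝ EM] [TopologicalSpace HM]
  {I : ModelWithCorners ℝ EM HM} [I.Boundaryless] [TopologicalSpace M] [ChartedSpace HM M]
  {EN HN N : Type*} [NormedAddCommGroup EN] [NormedSpace ℝ EN] [TopologicalSpace HN]
  {J : ModelWithCorners ℝ EN HN} [TopologicalSpace N] [ChartedSpace HN N]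

/-- A submersion has smooth local sections. -/
theorem Manifold.IsSubmersion.exists_local_section {k : ℕ∞ω} {f : M → N}
    (hf : IsSubmersion I J k f) (x : M) :
    ∃ (U : Set N) (s : N → M), IsOpen U ∧ f x ∈ U ∧ ContMDiffOn J I k s U ∧ s (f x) = x ∧
      ∀ y ∈ U, f (s y) = y := by
  have h := hf.isSubmersionAt x
  let φ := h.domChart
  let c := h.codChart
  let q := h.equiv
  have hxφ : x ∈ φ.source := h.mem_domChart_source
  have hxc : f x ∈ c.source := h.mem_codChart_source
  -- In the adapted charts `f` is the projection to the first factor. The section keeps the second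
  -- factor frozen at its value `w` at `x`, so that it passes through `x`.
  let w := (q (φ.extend I x)).2
  let r : N → EM := fun y => q.symm (c.extend J y, w)
  let s : N → M := fun y => (φ.extend I).symm (r y)
  have hw : ∀ z ∈ (φ.extend I).target, c.extend J (f ((φ.extend I).symm z)) = (q z).1 :=
    fun z hz => h.writtenInCharts hz
  have hxt : φ.extend I x ∈ (φ.extend I).target :=
    (φ.extend I).map_source (by rwa [φ.extend_source])
  have hrx : r (f x) = φ.extend I x := by
    have h1 := hw _ hxt
    rw [(φ.extend I).left_inv (by rwa [φ.extend_source])] at h1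
    change q.symm (c.extend J (f x), w) = _
    rw [h1]
    exact q.symm_apply_apply _
  have hcs : ContMDiffOn J 𝓘(ℝ, EN) k (c.extend J) c.source :=
    OpenPartialHomeomorph.contMDiffOn_extend h.codChart_mem_maximalAtlas
  have hr : ContMDiffOn J 𝓘(ℝ, EM) k r c.source :=
    q.symm.contDiff.contMDiff.comp_contMDiffOn (hcs.prodMk_space contMDiffOn_const)
  have hto : IsOpen (φ.extend I).target := φ.isOpen_extend_target
  refine ⟨c.source ∩ r ⁻¹' (φ.extend I).target, s,
    hr.continuousOn.isOpen_inter_preimage c.open_source hto,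
    ⟨hxc, by rw [mem_preimage, hrx]; exact hxt⟩, ?_, ?_, ?_⟩
  · have hsymm : ContMDiffOn 𝓘(ℝ, EM) I k (φ.extend I).symm (φ.extend I).target := by
      have := contMDiffOn_extend_symm (I := I) h.domChart_mem_maximalAtlas
      rwa [← φ.extend_target' ] at this
    exact hsymm.comp (hr.mono inter_subset_left) fun y hy => hy.2
  · change (φ.extend I).symm (r (f x)) = x
    rw [hrx, (φ.extend I).left_inv (by rwa [φ.extend_source])]
  · intro y hy
    have hs : s y ∈ φ.source := by
      have := (φ.extend I).map_target hy.2
      rwa [φ.extend_source] at this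
    have h1 := hw _ hy.2
    have h2 : (q (r y)).1 = c.extend J y := by
      change (q (q.symm (c.extend J y, w))).1 = _
      rw [q.apply_symm_apply]
    rw [h2] at h1
    refine (c.extend J).injOn ?_ ?_ h1
    · rw [c.extend_source]; exact h.source_subset_preimage_source hs
    · rw [c.extend_source]; exact hy.1

/-- Differentiating `f ∘ s = id` for a local section `s` through `x` gives a right inverse of the
tangent map. -/
theorem Manifold.IsSubmersion.mfderiv_surjective {k : ℕ∞ω} (hk : k ≠ 0) {f : M → N}
    (hf : IsSubmersion I J k f) (hfc : ContMDiff I J k f) (x : M) :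
    Function.Surjective (mfderiv I J f x) := by
  obtain ⟨U, s, hU, hxU, hs, hsx, hfs⟩ := hf.exists_local_section x
  have hsd : MDifferentiableAt J I s (f x) :=
    ((hs _ hxU).contMDiffAt (hU.mem_nhds hxU)).mdifferentiableAt hk
  have hfd : MDifferentiableAt I J f (s (f x)) := (hfc _).mdifferentiableAt hk
  have h1 := mfderiv_comp (f x) hfd hsd
  have h2 : f ∘ s =ᶠ[𝓝 (f x)] id := by
    filter_upwards [hU.mem_nhds hxU] with y hy using hfs y hy
  rw [h2.mfderiv_eq, mfderiv_id] at h1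
  intro v
  have h3 := congrArg (fun T => T v) h1
  rw [hsx] at h3
  exact ⟨mfderiv J I s (f x) v, h3.symm⟩

end Submersions

/-! ### Vertical lifts and fibre derivatives on the total space. -/

section VerticalLift

variable {n : ℕ} {B : Type*} [TopologicalSpace B] [ChartedSpace (EuclideanSpace ℝ (Fin n)) B]
  {F : Type*} [NormedAddCommGroup F] [NormedSpace ℝ F]
  {E : B → Type*} [TopologicalSpace (TotalSpace F E)]
  [∀ x, AddCommGroup (E x)] [∀ x, Module ℝ (E x)] [∀ x, TopologicalSpace (E x)]
  [FiberBundle F E] [VectorBundle ℝ F E]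

theorem contMDiff_fibreLine (a : TotalSpace F E) (b : E a.1) :
    ContMDiff 𝓘(ℝ, ℝ) (totalModel n F) ∞
      (fun t : ℝ => (⟨a.1, a.2 + t • b⟩ : TotalSpace F E)) := fun _ =>
  contMDiffAt_add_smul_along (f := fun _ : ℝ => a.1) (s := fun _ => a.2) (t := fun _ => b)
    contMDiffAt_const contMDiffAt_const contMDiffAt_id

theorem mdifferentiableAt_fibreLine (a : TotalSpace F E) (b : E a.1) :
    MDifferentiableAt 𝓘(ℝ, ℝ) (totalModel n F)
      (fun t : ℝ => (⟨a.1, a.2 + t • b⟩ : TotalSpace F E)) 0 :=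
  (contMDiff_fibreLine a b 0).mdifferentiableAt (by simp)

/-- The chain rule along `t ↦ a + t b`. -/
theorem mfderiv_verticalLift {EP HP P : Type*} [NormedAddCommGroup EP] [NormedSpace ℝ EP]
    [TopologicalSpace HP] {I : ModelWithCorners ℝ EP HP} [TopologicalSpace P] [ChartedSpace HP P]
    {g : TotalSpace F E → P} (a : TotalSpace F E) (hg : MDifferentiableAt (totalModel n F) I g a)
    (b : E a.1) :
    (mfderiv (totalModel n F) I g a (verticalLift a b) : EP) =
      mfderiv 𝓘(ℝ, ℝ) I (fun t : ℝ => g ⟨a.1, a.2 + t • b⟩) 0 (1 : ℝ) := by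
  have h0 : (⟨a.1, a.2 + (0 : ℝ) • b⟩ : TotalSpace F E) = a := by simp
  have hg' : MDifferentiableAt (totalModel n F) I g
      ((fun t : ℝ => (⟨a.1, a.2 + t • b⟩ : TotalSpace F E)) 0) := by
    change MDifferentiableAt (totalModel n F) I g ⟨a.1, a.2 + (0 : ℝ) • b⟩
    rwa [h0]
  have h := congrArg (fun T => T (1 : ℝ))
    (mfderiv_comp (0 : ℝ) hg' (mdifferentiableAt_fibreLine (n := n) a b))
  change mfderiv 𝓘(ℝ, ℝ) I (fun t : ℝ => g ⟨a.1, a.2 + t • b⟩) 0 (1 : ℝ) =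
    mfderiv (totalModel n F) I g ⟨a.1, a.2 + (0 : ℝ) • b⟩ (verticalLift a b) at h
  rw [h0] at h
  exact h.symm

variable [ContMDiffVectorBundle ∞ F E (𝓡 n)]

theorem Bundle.Trivialization.mdifferentiable_total (e : Trivialization F (π F E))
    [MemTrivializationAtlas e] :
    e.toOpenPartialHomeomorph.MDifferentiable (totalModel n F) (totalModel n F) :=
  ⟨(e.contMDiffOn (IB := 𝓡 n) (n := ∞)).mdifferentiableOn (by simp),
    (e.contMDiffOn_symm (IB := 𝓡 n) (n := ∞)).mdifferentiableOn (by simp)⟩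

/-- In the trivialization the line `t ↦ a + t b` has constant base point and affine fibre component.
Linearity and injectivity of the vertical lift, and its identification with the kernel of `Tτ`, are
all read off from this formula. -/
theorem mfderiv_trivialization_verticalLift (e : Trivialization F (π F E))
    [MemTrivializationAtlas e] {a : TotalSpace F E} (ha : a.1 ∈ e.baseSet) (b : E a.1) :
    (mfderiv (totalModel n F) (totalModel n F) e a (verticalLift a b) :
      EuclideanSpace ℝ (Fin n) × F) = (0, (e ⟨a.1, b⟩).2) := by
  have h1 := mfderiv_verticalLift (n := n) a
    ((e.mdifferentiable_total (n := n)).mdifferentiableAt (e.mem_source.2 ha)) b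
  refine h1.trans ?_
  have h2 : (fun t : ℝ => e ⟨a.1, a.2 + t • b⟩) =
      fun t : ℝ => (a.1, (e a).2 + t • (e ⟨a.1, b⟩).2) := by
    funext t
    have hl := e.linear ℝ ha
    refine Prod.ext (e.coe_fst' ha) ?_
    change (e ⟨a.1, a.2 + t • b⟩).2 = (e ⟨a.1, a.2⟩).2 + t • (e ⟨a.1, b⟩).2
    rw [hl.map_add, hl.map_smul]
  have h3 : HasFDerivAt (fun t : ℝ => (e a).2 + t • (e ⟨a.1, b⟩).2)
      ((1 : ℝ →L[ℝ] ℝ).smulRight (e ⟨a.1, b⟩).2) 0 :=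
    ((hasFDerivAt_id (𝕜 := ℝ) (0 : ℝ)).smul_const _).const_add _
  have h4 : HasMFDerivAt 𝓘(ℝ, ℝ) (totalModel n F)
      (fun t : ℝ => ((a.1, (e a).2 + t • (e ⟨a.1, b⟩).2) : B × F)) 0 _ :=
    (hasMFDerivAt_const (I := 𝓘(ℝ, ℝ)) (I' := 𝓡 n) a.1 (0 : ℝ)).prodMk h3.hasMFDerivAt
  have h5 := h4.congr_of_eventuallyEq (Filter.EventuallyEq.of_eq h2)
  refine (congrArg (fun T => T (1 : ℝ)) h5.mfderiv).trans ?_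
  refine Prod.ext rfl ?_
  change (1 : ℝ) • (e ⟨a.1, b⟩).2 = _
  rw [one_smul]

theorem mfderiv_trivialization_bijective (e : Trivialization F (π F E))
    [MemTrivializationAtlas e] {a : TotalSpace F E} (ha : a.1 ∈ e.baseSet) :
    Function.Bijective (mfderiv (totalModel n F) (totalModel n F) e a) :=
  ((e.mdifferentiable_total (n := n)).mfderiv (e.mem_source.2 ha)).bijective

theorem mfderiv_proj_eq_fst (e : Trivialization F (π F E))
    [MemTrivializationAtlas e] {a : TotalSpace F E} (ha : a.1 ∈ e.baseSet)
    (v : TangentSpace (totalModel n F) a) :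
    mfderiv (totalModel n F) (𝓡 n) TotalSpace.proj a v =
      (mfderiv (totalModel n F) (totalModel n F) e a v : EuclideanSpace ℝ (Fin n) × F).1 := by
  have hy := e.mem_source.2 ha
  have hd := (e.mdifferentiable_total (n := n)).mdifferentiableAt hy
  have h1 : HasMFDerivAt (totalModel n F) (𝓡 n) (Prod.fst ∘ e) a
      ((ContinuousLinearMap.fst ℝ (EuclideanSpace ℝ (Fin n)) F).comp
        (mfderiv (totalModel n F) (totalModel n F) e a)) :=
    HasMFDerivAt.comp a (hasMFDerivAt_fst (I := 𝓡 n) (I' := 𝓘(ℝ, F)) (e a)) hd.hasMFDerivAt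
  have h2 : (TotalSpace.proj : TotalSpace F E → B) =ᶠ[𝓝 a] (Prod.fst ∘ e) := by
    filter_upwards [e.open_source.mem_nhds hy] with x hx
    exact (e.coe_fst hx).symm
  rw [h2.mfderiv_eq, h1.mfderiv]
  rfl

theorem verticalLift_add (a : TotalSpace F E) (b c : E a.1) :
    verticalLift (n := n) a (b + c) = verticalLift a b + verticalLift a c := by
  let e := trivializationAt F E a.1
  have ha : a.1 ∈ e.baseSet := mem_baseSet_trivializationAt F E a.1
  apply (mfderiv_trivialization_bijective (n := n) e ha).1
  rw [map_add]
  refine (mfderiv_trivialization_verticalLift (n := n) e ha _).trans ?_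
  refine Eq.trans ?_ (congrArg₂ (fun x y : EuclideanSpace ℝ (Fin n) × F => x + y)
    (mfderiv_trivialization_verticalLift (n := n) e ha b)
    (mfderiv_trivialization_verticalLift (n := n) e ha c)).symm
  rw [(e.linear ℝ ha).map_add]
  exact Prod.ext (add_zero _).symm rfl

theorem verticalLift_smul (a : TotalSpace F E) (r : ℝ) (b : E a.1) :
    verticalLift (n := n) a (r • b) = r • verticalLift a b := by
  let e := trivializationAt F E a.1
  have ha : a.1 ∈ e.baseSet := mem_baseSet_trivializationAt F E a.1
  apply (mfderiv_trivialization_bijective (n := n) e ha).1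
  rw [map_smul]
  refine (mfderiv_trivialization_verticalLift (n := n) e ha _).trans ?_
  refine Eq.trans ?_ (congrArg (fun x : EuclideanSpace ℝ (Fin n) × F => r • x)
    (mfderiv_trivialization_verticalLift (n := n) e ha b)).symm
  rw [(e.linear ℝ ha).map_smul]
  exact Prod.ext (smul_zero _).symm rfl

variable (n) in
/-- The vertical lift at `a` as a linear map. -/
def verticalLiftₗ (a : TotalSpace F E) : E a.1 →ₗ[ℝ] TangentSpace (totalModel n F) a where
  toFun := verticalLift a
  map_add' := verticalLift_add a
  map_smul' := verticalLift_smul a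

theorem verticalLift_injective (a : TotalSpace F E) :
    Function.Injective (verticalLift (n := n) a) := by
  let e := trivializationAt F E a.1
  have ha : a.1 ∈ e.baseSet := mem_baseSet_trivializationAt F E a.1
  intro b c h
  have h1 := mfderiv_trivialization_verticalLift (n := n) e ha b
  rw [h, mfderiv_trivialization_verticalLift (n := n) e ha c] at h1
  exact (e.continuousLinearEquivAt ℝ _ ha).injective (congrArg Prod.snd h1).symm

theorem mfderiv_proj_verticalLift (a : TotalSpace F E) (b : E a.1) :
    mfderiv (totalModel n F) (𝓡 n) TotalSpace.proj a (verticalLift a b) = 0 := by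
  let e := trivializationAt F E a.1
  have ha : a.1 ∈ e.baseSet := mem_baseSet_trivializationAt F E a.1
  rw [mfderiv_proj_eq_fst e ha, mfderiv_trivialization_verticalLift e ha]
  rfl

/-- In a trivialization the kernel of `Tτ` is `0 × F`, which the vertical lift fills. -/
theorem exists_verticalLift_eq {a : TotalSpace F E} {v : TangentSpace (totalModel n F) a}
    (hv : mfderiv (totalModel n F) (𝓡 n) TotalSpace.proj a v = 0) :
    ∃ b : E a.1, verticalLift a b = v := by
  let e := trivializationAt F E a.1
  have ha : a.1 ∈ e.baseSet := mem_baseSet_trivializationAt F E a.1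
  rw [mfderiv_proj_eq_fst e ha] at hv
  refine ⟨e.symm a.1
    (mfderiv (totalModel n F) (totalModel n F) e a v : EuclideanSpace ℝ (Fin n) × F).2, ?_⟩
  apply (mfderiv_trivialization_bijective (n := n) e ha).1
  refine (mfderiv_trivialization_verticalLift (n := n) e ha _).trans ?_
  rw [e.apply_mk_symm ha]
  exact Prod.ext hv.symm rfl

theorem mfderiv_proj_surjective (a : TotalSpace F E) :
    Function.Surjective
      (mfderiv (totalModel n F) (𝓡 n) (TotalSpace.proj : TotalSpace F E → B) a) := by
  let e := trivializationAt F E a.1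
  have ha : a.1 ∈ e.baseSet := mem_baseSet_trivializationAt F E a.1
  intro u
  obtain ⟨v, hv⟩ := (mfderiv_trivialization_bijective (n := n) e ha).2
    ((u, 0) : EuclideanSpace ℝ (Fin n) × F)
  refine ⟨v, ?_⟩
  rw [mfderiv_proj_eq_fst e ha]
  exact congrArg Prod.fst hv

variable [IsManifold (𝓡 n) ∞ B]

/-- The fibre derivative of a smooth function in the direction of a smooth fibre-preserving map is
smooth. -/
theorem contMDiff_dirDeriv_verticalLift {L : TotalSpace F E → ℝ}
    (hL : ContMDiff (totalModel n F) 𝓘(ℝ, ℝ) ∞ L) {s : ∀ a : TotalSpace F E, E a.1}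
    (hs : ContMDiff (totalModel n F) (totalModel n F) ∞
      (fun a : TotalSpace F E => (⟨a.1, s a⟩ : TotalSpace F E))) :
    ContMDiff (totalModel n F) 𝓘(ℝ, ℝ) ∞
      (fun a => dirDeriv (totalModel n F) L a (verticalLift a (s a))) := by
  intro a₀
  -- The fibre derivative is the `t`-derivative at `0` of this function, which is jointly smooth in
  -- `a` and `t`, so it depends smoothly on the parameter `a`.
  let f : TotalSpace F E → ℝ → ℝ := fun a t => L ⟨a.1, a.2 + t • s a⟩
  have hf : ContMDiff ((totalModel n F).prod 𝓘(ℝ, ℝ)) 𝓘(ℝ, ℝ) ∞ (Function.uncurry f) := by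
    refine hL.comp fun p => ?_
    exact contMDiffAt_add_smul_along (f := fun p : TotalSpace F E × ℝ => p.1.1)
      (s := fun p => p.1.2) (t := fun p => s p.1) (c := fun p => p.2)
      contMDiffAt_fst (hs.contMDiffAt.comp p contMDiffAt_fst) contMDiffAt_snd
  have h1 := ContMDiffAt.mfderiv f (fun _ => (0 : ℝ)) (hf (a₀, 0)) contMDiffAt_const
    (m := ∞) (by simp)
  have h1' : ContMDiffAt (totalModel n F) 𝓘(ℝ, ℝ →L[ℝ] ℝ) ∞
      (fun a => (mfderiv 𝓘(ℝ, ℝ) 𝓘(ℝ, ℝ) (f a) 0 : ℝ →L[ℝ] ℝ)) a₀ :=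
    h1.congr_of_eventuallyEq (Filter.Eventually.of_forall fun a =>
      congrFun (inTangentCoordinates_model_space (I := 𝓘(ℝ, ℝ)) (I' := 𝓘(ℝ, ℝ))
        (fun _ : TotalSpace F E => (0 : ℝ)) (fun a => f a 0)
        (fun a => (mfderiv 𝓘(ℝ, ℝ) 𝓘(ℝ, ℝ) (f a) 0 : ℝ →L[ℝ] ℝ)) a₀).symm a)
  have h2 := h1'.clm_apply (contMDiffAt_const (c := (1 : ℝ)))
  refine h2.congr_of_eventuallyEq (Filter.Eventually.of_forall fun a => ?_)
  exact mfderiv_verticalLift (n := n) a ((hL a).mdifferentiableAt (by simp)) (s a)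

theorem contMDiff_energy {L : TotalSpace F E → ℝ}
    (hL : ContMDiff (totalModel n F) 𝓘(ℝ, ℝ) ∞ L) :
    ContMDiff (totalModel n F) 𝓘(ℝ, ℝ) ∞ (energy n L) :=
  (contMDiff_dirDeriv_verticalLift hL (s := fun a => a.2) contMDiff_id).sub hL

end VerticalLift

/-! ### Cut-off local frames and coframes. -/

section Frames

variable {n : ℕ} {B : Type*} [TopologicalSpace B] [ChartedSpace (EuclideanSpace ℝ (Fin n)) B]
  {F : Type*} [NormedAddCommGroup F] [NormedSpace ℝ F]
  {E : B → Type*} [TopologicalSpace (TotalSpace F E)]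
  [∀ x, AddCommGroup (E x)] [∀ x, Module ℝ (E x)] [∀ x, TopologicalSpace (E x)]
  [FiberBundle F E] [VectorBundle ℝ F E] [ContMDiffVectorBundle ∞ F E (𝓡 n)]

variable (n F) in
/-- A family of linear forms on the fibres which is smooth on the total space. -/
def IsSmoothCovector (β : ∀ m, E m →ₗ[ℝ] ℝ) : Prop :=
  ContMDiff (totalModel n F) 𝓘(ℝ, ℝ) ∞ (fun b : TotalSpace F E => β b.1 b.2)

/-- Around every point there is a smooth local frame with its dual coframe, cut off so as to be
globally defined. -/
theorem exists_cutoff_frame [T2Space B] [IsManifold (𝓡 n) ∞ B] [FiniteDimensional ℝ F] (m₀ : B) :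
    ∃ (d : ℕ) (e : Fin d → SmoothSec n F E) (β : Fin d → ∀ m, E m →ₗ[ℝ] ℝ)
      (c : C^∞⟮𝓡 n, B; 𝓘(ℝ, ℝ), ℝ⟯),
      (∀ i, IsSmoothCovector n F (β i)) ∧ (∀ m b, ∑ i, β i m b • e i m = c m • b) ∧
        (c : B → ℝ) =ᶠ[𝓝 m₀] 1 := by
  let t := trivializationAt F E m₀
  have ht : m₀ ∈ t.baseSet := mem_baseSet_trivializationAt F E m₀
  obtain ⟨χ, -, hχ⟩ := (SmoothBumpFunction.nhds_basis_tsupport (I := 𝓡 n) m₀).mem_iff.1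
    (t.open_baseSet.mem_nhds ht)
  have hχ' : ∀ m, m ∉ t.baseSet → χ m = 0 := fun m hm => by
    by_contra h
    exact hm (hχ (subset_tsupport _ h))
  let b := Module.finBasis ℝ F
  let e : Fin (Module.finrank ℝ F) → SmoothSec n F E := fun i =>
    ⟨fun m => χ m • t.symm m (b i), by
      refine ContMDiffOn.smul_section_of_tsupport χ.contMDiff.contMDiffOn t.open_baseSet hχ ?_
      intro x hx
      rw [t.contMDiffWithinAt_section _ hx]
      have h : ContMDiffOn (𝓡 n) 𝓘(ℝ, F) ∞ (fun _ : B => b i) t.baseSet := contMDiffOn_const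
      exact (h.congr fun y hy => by rw [t.apply_mk_symm hy]) x hx⟩
  let β : Fin (Module.finrank ℝ F) → ∀ m, E m →ₗ[ℝ] ℝ := fun i m =>
    χ m • (b.coord i).comp (t.linearMapAt ℝ m)
  have hβ : ∀ i m v, m ∈ t.baseSet → β i m v = χ m * b.coord i (t ⟨m, v⟩).2 := by
    intro i m v hm
    change χ m • b.coord i (t.linearMapAt ℝ m v) = _
    rw [t.coe_linearMapAt_of_mem (R := ℝ) hm]
    rfl
  -- The frame and the coframe each carry one factor `χ`, so the function in the expansion is `χ²`,
  -- which is still `1` near `m₀`.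
  refine ⟨_, e, β, ⟨fun m => χ m * χ m, χ.contMDiff.mul χ.contMDiff⟩, fun i => ?_, fun m v => ?_, ?_⟩
  · refine contMDiff_of_tsupport fun a ha => ?_
    have ha' : a.1 ∈ t.baseSet := by
      have hcl : tsupport (fun a : TotalSpace F E => β i a.1 a.2) ⊆
          TotalSpace.proj ⁻¹' tsupport χ := by
        refine closure_minimal (fun x hx => subset_tsupport χ ?_)
          ((isClosed_tsupport χ).preimage (FiberBundle.continuous_proj F E))
        intro h
        apply hx
        change χ x.1 • _ = (0 : ℝ)
        rw [h, zero_smul]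
      exact hχ (hcl ha)
    have h1 : ContMDiffAt (totalModel n F) 𝓘(ℝ, ℝ) ∞ (fun a : TotalSpace F E => χ a.1) a :=
      χ.contMDiff.contMDiffAt.comp a (contMDiff_proj E).contMDiffAt
    have h2 : ContMDiffAt (totalModel n F) 𝓘(ℝ, F) ∞ (fun a : TotalSpace F E => (t a).2) a :=
      ((t.contMDiffAt_iff (t.mem_source.2 ha')).1 contMDiffAt_id).2
    have h3 : ContMDiffAt (totalModel n F) 𝓘(ℝ, ℝ) ∞
        (fun a : TotalSpace F E => b.coord i (t a).2) a :=
      (LinearMap.toContinuousLinearMap (b.coord i)).contMDiff.contMDiffAt.comp a h2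
    refine (h1.mul h3).congr_of_eventuallyEq ?_
    filter_upwards [t.open_source.mem_nhds (t.mem_source.2 ha')] with y hy
    exact hβ i y.1 y.2 (t.mem_source.1 hy)
  · by_cases hm : m ∈ t.baseSet
    · have h1 : ∀ i, β i m v • e i m =
          (χ m * χ m) • (b.coord i (t ⟨m, v⟩).2 • (t.continuousLinearEquivAt ℝ m hm).symm (b i)) := by
        intro i
        rw [hβ i m v hm]
        change (χ m * _) • (χ m • (t.continuousLinearEquivAt ℝ m hm).symm (b i)) = _
        rw [smul_smul, smul_smul]
        congr 1
        ring
      rw [Finset.sum_congr rfl fun i _ => h1 i, ← Finset.smul_sum]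
      change _ = (χ m * χ m) • v
      congr 1
      simp_rw [← map_smul]
      rw [← map_sum]
      have h2 : ∑ i, b.coord i (t ⟨m, v⟩).2 • b i = (t ⟨m, v⟩).2 := b.sum_repr _
      rw [h2]
      exact (t.continuousLinearEquivAt ℝ m hm).symm_apply_apply v
    · have h0 := hχ' m hm
      change _ = (χ m * χ m) • v
      rw [h0, zero_mul, zero_smul]
      refine Finset.sum_eq_zero fun i _ => ?_
      change _ • χ m • _ = (0 : E m)
      rw [h0, zero_smul, smul_zero]
  · filter_upwards [χ.eventuallyEq_one] with m hm
    change χ m * χ m = 1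
    rw [hm]
    simp

theorem exists_smoothSec [T2Space B] [IsManifold (𝓡 n) ∞ B] [FiniteDimensional ℝ F] (m : B)
    (b : E m) : ∃ σ : SmoothSec n F E, σ m = b := by
  obtain ⟨d, e, β, c, -, h, hc⟩ := exists_cutoff_frame (n := n) (F := F) (E := E) m
  refine ⟨∑ i, β i m b • e i, ?_⟩
  have h1 : (∑ i, β i m b • e i : SmoothSec n F E) m = ∑ i, β i m b • e i m := by
    exact (map_sum (⟨⟨fun σ : SmoothSec n F E => σ m, rfl⟩, fun _ _ => rfl⟩ :
      SmoothSec n F E →+ E m) _ _)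
  rw [h1, h, hc.self_of_nhds]
  simp

end Frames

/-! ### The fibre derivative in a frame. -/

section FibreDeriv

variable {n : ℕ} {B : Type*} [TopologicalSpace B] [ChartedSpace (EuclideanSpace ℝ (Fin n)) B]
  {F : Type*} [NormedAddCommGroup F] [NormedSpace ℝ F]
  {E : B → Type*} [TopologicalSpace (TotalSpace F E)]
  [∀ x, AddCommGroup (E x)] [∀ x, Module ℝ (E x)] [∀ x, TopologicalSpace (E x)]
  [FiberBundle F E] [VectorBundle ℝ F E] [ContMDiffVectorBundle ∞ F E (𝓡 n)]

variable (n) in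
/-- The fibre derivative (Legendre transformation) `b ↦ d/dt L(a + t b)` at `t = 0`. -/
def fibreDeriv (L : TotalSpace F E → ℝ) (a : TotalSpace F E) : E a.1 →ₗ[ℝ] ℝ :=
  (mfderiv (totalModel n F) 𝓘(ℝ, ℝ) L a).toLinearMap ∘ₗ verticalLiftₗ n a

theorem fibreDeriv_apply (L : TotalSpace F E → ℝ) (a : TotalSpace F E) (b : E a.1) :
    fibreDeriv n L a b = dirDeriv (totalModel n F) L a (verticalLift a b) := rfl

theorem contMDiff_fibreDeriv_section [IsManifold (𝓡 n) ∞ B] {L : TotalSpace F E → ℝ}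
    (hL : ContMDiff (totalModel n F) 𝓘(ℝ, ℝ) ∞ L) (σ : SmoothSec n F E) :
    ContMDiff (totalModel n F) 𝓘(ℝ, ℝ) ∞ (fun a => fibreDeriv n L a (σ a.1)) :=
  contMDiff_dirDeriv_verticalLift hL (s := fun a => σ a.1)
    (σ.contMDiff.comp (contMDiff_proj E))

variable {EP HP P : Type*} [NormedAddCommGroup EP] [NormedSpace ℝ EP]
  [TopologicalSpace HP] {I : ModelWithCorners ℝ EP HP} [TopologicalSpace P] [ChartedSpace HP P]

theorem dirDeriv_sum_mul {d : ℕ} {g h : Fin d → P → ℝ} {x : P} (u : TangentSpace I x)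
    (hg : ∀ i, MDifferentiableAt I 𝓘(ℝ, ℝ) (g i) x)
    (hh : ∀ i, MDifferentiableAt I 𝓘(ℝ, ℝ) (h i) x) :
    dirDeriv I (fun y => ∑ i, g i y * h i y) x u =
      ∑ i, (dirDeriv I (g i) x u * h i x + g i x * dirDeriv I (h i) x u) := by
  have h1 := HasMFDerivAt.sum (t := Finset.univ)
    (fun i (_ : i ∈ Finset.univ) => (hg i).hasMFDerivAt.mul (hh i).hasMFDerivAt)
  have h2 : (fun y => ∑ i, g i y * h i y) = ∑ i, g i * h i := by
    ext y
    simp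
  unfold dirDeriv
  rw [h2, h1.mfderiv]
  refine (map_sum (AddMonoidHom.mk' (fun T : EP →L[ℝ] ℝ => T u) fun _ _ => rfl) _ _).trans ?_
  refine Finset.sum_congr rfl fun i _ => ?_
  change g i x * dirDeriv I (h i) x u + h i x * dirDeriv I (g i) x u =
    dirDeriv I (g i) x u * h i x + g i x * dirDeriv I (h i) x u
  ring

theorem dirDeriv_comp {EQ HQ Q : Type*} [NormedAddCommGroup EQ] [NormedSpace ℝ EQ]
    [TopologicalSpace HQ] {J : ModelWithCorners ℝ EQ HQ} [TopologicalSpace Q] [ChartedSpace HQ Q]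
    {f : Q → ℝ} {g : P → Q} {x : P} (hf : MDifferentiableAt J 𝓘(ℝ, ℝ) f (g x))
    (hg : MDifferentiableAt I J g x) (u : TangentSpace I x) :
    dirDeriv I (fun y => f (g y)) x u = dirDeriv J f (g x) (mfderiv I J g x u) := by
  have h := mfderiv_comp x hf hg
  exact congrArg (fun T => T u) h

/-- The derivative of `y ↦ FL(G y)(s y)` for a section `s` along `τ ∘ G`, computed in a frame. -/
theorem dirDeriv_fibreDeriv_along [IsManifold (𝓡 n) ∞ B] {L : TotalSpace F E → ℝ}
    (hL : ContMDiff (totalModel n F) 𝓘(ℝ, ℝ) ∞ L) {d : ℕ} {e : Fin d → SmoothSec n F E}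
    {β : Fin d → ∀ m, E m →ₗ[ℝ] ℝ} {c : C^∞⟮𝓡 n, B; 𝓘(ℝ, ℝ), ℝ⟯}
    (hβ : ∀ i, IsSmoothCovector n F (β i)) (hsum : ∀ m b, ∑ i, β i m b • e i m = c m • b)
    {G : P → TotalSpace F E} {s : ∀ y, E (G y).1} {x : P}
    (hc : (c : B → ℝ) =ᶠ[𝓝 (G x).1] 1)
    (hG : ContMDiffAt I (totalModel n F) ∞ G x)
    (hs : ContMDiffAt I (totalModel n F) ∞ (fun y => (⟨(G y).1, s y⟩ : TotalSpace F E)) x)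
    (u : TangentSpace I x) :
    dirDeriv I (fun y => fibreDeriv n L (G y) (s y)) x u =
      ∑ i, (dirDeriv I (fun y => β i (G y).1 (s y)) x u * fibreDeriv n L (G x) (e i (G x).1) +
        β i (G x).1 (s x) * dirDeriv (totalModel n F) (fun a => fibreDeriv n L a (e i a.1)) (G x)
          (mfderiv I (totalModel n F) G x u)) := by
  have hp : ContMDiffAt I (𝓡 n) ∞ (fun y => (G y).1) x :=
    (contMDiff_proj E).contMDiffAt.comp x hG
  -- Where the cut-off equals `1`, the section is `∑ᵢ βᵢ(s) eᵢ`. Linearity of the fibre derivative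
  -- turns the function into a sum of products, to which the product rule applies.
  have h1 : (fun y => fibreDeriv n L (G y) (s y)) =ᶠ[𝓝 x]
      fun y => ∑ i, β i (G y).1 (s y) * fibreDeriv n L (G y) (e i (G y).1) := by
    filter_upwards [hp.continuousAt.eventually hc] with y hy
    have h2 := congrArg (fibreDeriv n L (G y)) (hsum (G y).1 (s y))
    rw [hy, map_sum] at h2
    simpa using h2.symm
  have h3 : ∀ i, MDifferentiableAt I 𝓘(ℝ, ℝ) (fun y => β i (G y).1 (s y)) x := fun i =>
    ((hβ i).contMDiffAt.comp x hs).mdifferentiableAt (by simp)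
  have h4 : ∀ i, MDifferentiableAt (totalModel n F) 𝓘(ℝ, ℝ)
      (fun a => fibreDeriv n L a (e i a.1)) (G x) := fun i =>
    (contMDiff_fibreDeriv_section hL (e i)).contMDiffAt.mdifferentiableAt (by simp)
  have h5 := hG.mdifferentiableAt (by simp)
  have h6 : dirDeriv I (fun y => fibreDeriv n L (G y) (s y)) x u =
      dirDeriv I (fun y => ∑ i, β i (G y).1 (s y) * fibreDeriv n L (G y) (e i (G y).1)) x u := by
    unfold dirDeriv
    rw [h1.mfderiv_eq]
    rfl
  have h7 : ∀ i, MDifferentiableAt I 𝓘(ℝ, ℝ) (fun y => fibreDeriv n L (G y) (e i (G y).1)) x :=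
    fun i => (h4 i).comp x h5
  rw [h6, dirDeriv_sum_mul u h3 h7]
  refine Finset.sum_congr rfl fun i _ => ?_
  rw [← dirDeriv_comp (h4 i) h5]

end FibreDeriv

/-! ### Exterior differentials in degrees 0 and 1, and their tensoriality. -/

section LowDegree

variable {n : ℕ} {B : Type*} [TopologicalSpace B] [ChartedSpace (EuclideanSpace ℝ (Fin n)) B]
  [IsManifold (𝓡 n) ∞ B]
  {F : Type*} [NormedAddCommGroup F] [NormedSpace ℝ F]
  {E : B → Type*} [TopologicalSpace (TotalSpace F E)]
  [∀ x, AddCommGroup (E x)] [∀ x, Module ℝ (E x)] [∀ x, TopologicalSpace (E x)]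
  [FiberBundle F E] [VectorBundle ℝ F E] [ContMDiffVectorBundle ∞ F E (𝓡 n)]

theorem IsSmoothCovector.contMDiff_apply {β : ∀ m, E m →ₗ[ℝ] ℝ} (hβ : IsSmoothCovector n F β)
    (σ : SmoothSec n F E) : ContMDiff (𝓡 n) 𝓘(ℝ, ℝ) ∞ (fun m => β m (σ m)) :=
  ContMDiff.comp (g := fun b : TotalSpace F E => β b.1 b.2) hβ σ.contMDiff

namespace LieAlgebroid

variable (A : LieAlgebroid n F E)

/-- The exterior differential `ρ(σ)(β η) - ρ(η)(β σ) - β [σ, η]` of a 1-form. -/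
def dCovector (β : ∀ m, E m →ₗ[ℝ] ℝ) (σ η : SmoothSec n F E) (m : B) : ℝ :=
  dirDeriv (𝓡 n) (fun x => β x (η x)) m (A.anchor m (σ m)) -
    dirDeriv (𝓡 n) (fun x => β x (σ x)) m (A.anchor m (η m)) - β m (A.bracket σ η m)

theorem dCovector_skew (β : ∀ m, E m →ₗ[ℝ] ℝ) (σ η : SmoothSec n F E) (m : B) :
    A.dCovector β σ η m = - A.dCovector β η σ m := by
  unfold dCovector
  rw [A.bracket_skew σ η]
  have : (-A.bracket η σ) m = -(A.bracket η σ m) := rfl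
  rw [this, map_neg]
  ring

theorem extDiff_ofSubsingleton (β : ∀ m, E m →ₗ[ℝ] ℝ) (σ : Fin 2 → SmoothSec n F E) (m : B) :
    A.extDiff (fun m => AlternatingMap.ofSubsingleton ℝ (E m) ℝ (0 : Fin 1) (β m)) σ m =
      A.dCovector β (σ 0) (σ 1) m := by
  simp [extDiff, koszulDifferential, dCovector, Fin.sum_univ_two]
  ring

theorem extDiff_constOfIsEmpty (f : B → ℝ) (σ : Fin 1 → SmoothSec n F E) (m : B) :
    A.extDiff (fun m => AlternatingMap.constOfIsEmpty ℝ (E m) (Fin 0) (f m)) σ m =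
      dirDeriv (𝓡 n) f m (A.anchor m (σ 0 m)) := by
  simp [extDiff, koszulDifferential]

theorem bracket_sum_right {d : ℕ} (σ : SmoothSec n F E) (η : Fin d → SmoothSec n F E) :
    A.bracket σ (∑ i, η i) = ∑ i, A.bracket σ (η i) :=
  map_sum (AddMonoidHom.mk' (A.bracket σ) (A.bracket_add_right σ)) _ _

theorem _root_.SmoothSec.sum_apply {d : ℕ} (η : Fin d → SmoothSec n F E) (m : B) :
    (∑ i, η i) m = ∑ i, η i m :=
  map_sum (AddMonoidHom.mk' (fun σ : SmoothSec n F E => σ m) fun _ _ => rfl) _ _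

/-- The differential of a 1-form vanishes on sections vanishing at the point. -/
theorem dCovector_eq_zero [T2Space B] [FiniteDimensional ℝ F] {β : ∀ m, E m →ₗ[ℝ] ℝ}
    (hβ : IsSmoothCovector n F β) (σ δ : SmoothSec n F E) {m : B} (hδ : δ m = 0) :
    A.dCovector β σ δ m = 0 := by
  obtain ⟨d, e, b, c, hb, hsum, hc⟩ := exists_cutoff_frame (n := n) (F := F) (E := E) m
  let g : Fin d → C^∞⟮𝓡 n, B; 𝓘(ℝ, ℝ), ℝ⟯ := fun i => ⟨_, (hb i).contMDiff_apply δ⟩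
  have hg : ∀ i x, g i x = b i x (δ x) := fun _ _ => rfl
  have hgm : ∀ i, g i m = 0 := fun i => by rw [hg, hδ, map_zero]
  -- The coefficients `gᵢ = βᵢ(δ)` vanish at `m`, so the Leibniz rule leaves only their derivatives.
  -- Both the bracket and the derivative of `β(δ)` become sums over these derivatives, and they
  -- cancel.
  have h1 : smulSec c δ = ∑ i, smulSec (g i) (e i) := by
    ext x
    rw [SmoothSec.sum_apply]
    exact (hsum x (δ x)).symm
  have h2 : A.bracket σ δ m =
      ∑ i, dirDeriv (𝓡 n) (g i) m (A.anchor m (σ m)) • e i m := by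
    -- The derivative of the cut-off `c` multiplies `δ m = 0`, and `c m = 1`, so bracketing with `c
    -- δ` instead of `δ` changes nothing at `m`.
    have h3 := A.leibniz σ δ c m
    rw [h1, A.bracket_sum_right, SmoothSec.sum_apply, hδ, smul_zero, add_zero,
      hc.self_of_nhds, Pi.one_apply, one_smul] at h3
    rw [← h3]
    refine Finset.sum_congr rfl fun i _ => ?_
    rw [A.leibniz, hgm, zero_smul, zero_add]
  have h4 : (fun x => β x (δ x)) =ᶠ[𝓝 m] fun x => ∑ i, g i x * β x (e i x) := by
    filter_upwards [hc] with x hx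
    have h5 := congrArg (β x) (hsum x (δ x))
    rw [hx, map_sum] at h5
    simpa [hg] using h5.symm
  have h6 : dirDeriv (𝓡 n) (fun x => β x (δ x)) m (A.anchor m (σ m)) =
      ∑ i, dirDeriv (𝓡 n) (g i) m (A.anchor m (σ m)) * β m (e i m) := by
    have h7 : dirDeriv (𝓡 n) (fun x => β x (δ x)) m (A.anchor m (σ m)) =
        dirDeriv (𝓡 n) (fun x => ∑ i, g i x * β x (e i x)) m (A.anchor m (σ m)) := by
      unfold dirDeriv
      rw [h4.mfderiv_eq]
      rfl
    rw [h7, dirDeriv_sum_mul _ (fun i => (g i).contMDiff.contMDiffAt.mdifferentiableAt (by simp))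
      fun i => (hβ.contMDiff_apply (e i)).contMDiffAt.mdifferentiableAt (by simp)]
    refine Finset.sum_congr rfl fun i _ => ?_
    rw [hgm, zero_mul, add_zero]
  have h8 : dirDeriv (𝓡 n) (fun x => β x (σ x)) m (A.anchor m (δ m)) = 0 := by
    rw [hδ, map_zero]
    exact map_zero (mfderiv (𝓡 n) 𝓘(ℝ, ℝ) (fun x => β x (σ x)) m)
  unfold dCovector
  rw [h8, h6, h2, map_sum, sub_zero, sub_eq_zero]
  refine Finset.sum_congr rfl fun i _ => ?_
  rw [map_smul, smul_eq_mul]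

theorem dCovector_sub_right {β : ∀ m, E m →ₗ[ℝ] ℝ}
    (hβ : IsSmoothCovector n F β) (σ η ξ : SmoothSec n F E) (m : B) :
    A.dCovector β σ (η - ξ) m = A.dCovector β σ η m - A.dCovector β σ ξ m := by
  have h1 : A.bracket σ (η - ξ) = A.bracket σ η - A.bracket σ ξ :=
    map_sub (AddMonoidHom.mk' (A.bracket σ) (A.bracket_add_right σ)) _ _
  have h2 : ∀ ζ : SmoothSec n F E, MDifferentiableAt (𝓡 n) 𝓘(ℝ, ℝ) (fun x => β x (ζ x)) m :=
    fun ζ => (hβ.contMDiff_apply ζ).contMDiffAt.mdifferentiableAt (by simp)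
  have h3 : dirDeriv (𝓡 n) (fun x => β x ((η - ξ) x)) m (A.anchor m (σ m)) =
      dirDeriv (𝓡 n) (fun x => β x (η x)) m (A.anchor m (σ m)) -
        dirDeriv (𝓡 n) (fun x => β x (ξ x)) m (A.anchor m (σ m)) := by
    have h4 : (fun x => β x ((η - ξ) x)) = (fun x => β x (η x)) - fun x => β x (ξ x) :=
      funext fun x => map_sub (β x) (η x) (ξ x)
    unfold dirDeriv
    rw [h4, ((h2 η).hasMFDerivAt.sub (h2 ξ).hasMFDerivAt).mfderiv]
    rfl
  have h5 : dirDeriv (𝓡 n) (fun x => β x (σ x)) m (A.anchor m ((η - ξ) m)) =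
      dirDeriv (𝓡 n) (fun x => β x (σ x)) m (A.anchor m (η m)) -
        dirDeriv (𝓡 n) (fun x => β x (σ x)) m (A.anchor m (ξ m)) := by
    have : (η - ξ) m = η m - ξ m := rfl
    rw [this, map_sub]
    exact map_sub (mfderiv (𝓡 n) 𝓘(ℝ, ℝ) (fun x => β x (σ x)) m) _ _
  have h6 : β m ((A.bracket σ η - A.bracket σ ξ) m) = β m (A.bracket σ η m) - β m (A.bracket σ ξ m) :=
    map_sub (β m) _ _
  unfold dCovector
  rw [h3, h5, h1, h6]
  ring

/-- The differential of a 1-form is tensorial. -/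
theorem dCovector_congr [T2Space B] [FiniteDimensional ℝ F] {β : ∀ m, E m →ₗ[ℝ] ℝ}
    (hβ : IsSmoothCovector n F β) {σ σ' η η' : SmoothSec n F E} {m : B} (hσ : σ' m = σ m)
    (hη : η' m = η m) : A.dCovector β σ' η' m = A.dCovector β σ η m := by
  have key : ∀ ζ ξ ξ' : SmoothSec n F E, ξ' m = ξ m →
      A.dCovector β ζ ξ' m = A.dCovector β ζ ξ m := by
    intro ζ ξ ξ' h
    have h1 := A.dCovector_eq_zero hβ ζ (ξ' - ξ) (m := m) (sub_eq_zero.2 h)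
    rw [A.dCovector_sub_right hβ] at h1
    exact sub_eq_zero.1 h1
  rw [key σ' η η' hη, A.dCovector_skew, key η σ σ' hσ, ← A.dCovector_skew]

end LieAlgebroid
end LowDegree

/-! ### Bundle maps, their tangent maps, and what a morphism gives in low degree. -/

section BundleMap

variable {n : ℕ} {B : Type*} [TopologicalSpace B] [ChartedSpace (EuclideanSpace ℝ (Fin n)) B]
  [IsManifold (𝓡 n) ∞ B]
  {F : Type*} [NormedAddCommGroup F] [NormedSpace ℝ F]
  {E : B → Type*} [TopologicalSpace (TotalSpace F E)]
  [∀ x, AddCommGroup (E x)] [∀ x, Module ℝ (E x)] [∀ x, TopologicalSpace (E x)]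
  [FiberBundle F E] [VectorBundle ℝ F E] [ContMDiffVectorBundle ∞ F E (𝓡 n)]
  {n' : ℕ} {B' : Type*} [TopologicalSpace B'] [ChartedSpace (EuclideanSpace ℝ (Fin n')) B']
  [IsManifold (𝓡 n') ∞ B']
  {F' : Type*} [NormedAddCommGroup F'] [NormedSpace ℝ F']
  {E' : B' → Type*} [TopologicalSpace (TotalSpace F' E')]
  [∀ x, AddCommGroup (E' x)] [∀ x, Module ℝ (E' x)] [∀ x, TopologicalSpace (E' x)]
  [FiberBundle F' E'] [VectorBundle ℝ F' E'] [ContMDiffVectorBundle ∞ F' E' (𝓡 n')]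

namespace SmoothBundleMap

variable (Φ : SmoothBundleMap n F E n' F' E')

theorem contMDiff_base : ContMDiff (𝓡 n) (𝓡 n') ∞ Φ.base :=
  (contMDiff_proj E').comp (Φ.contMDiff_total.comp (contMDiff_zeroSection ℝ E))

theorem mdifferentiableAt_base (m : B) : MDifferentiableAt (𝓡 n) (𝓡 n') Φ.base m :=
  (Φ.contMDiff_base m).mdifferentiableAt (by simp)

theorem mdifferentiableAt_total (a : TotalSpace F E) :
    MDifferentiableAt (totalModel n F) (totalModel n' F') Φ.total a :=
  (Φ.contMDiff_total a).mdifferentiableAt (by simp)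

/-- By fibrewise linearity, `Φ` carries the line `a + t b` to the line `Φ(a) + t Φ(b)`. This is why
the prolongation of `Φ` commutes with the vertical endomorphisms. -/
theorem mfderiv_total_verticalLift (a : TotalSpace F E) (b : E a.1) :
    mfderiv (totalModel n F) (totalModel n' F') Φ.total a (verticalLift a b) =
      verticalLift (Φ.total a) (Φ.fib a.1 b) := by
  refine (mfderiv_verticalLift a (Φ.mdifferentiableAt_total a) b).trans ?_
  let b' : E' (Φ.total a).1 := Φ.fib a.1 b
  have h : (fun t : ℝ => Φ.total ⟨a.1, a.2 + t • b⟩) =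
      fun t : ℝ => (⟨(Φ.total a).1, (Φ.total a).2 + t • b'⟩ : TotalSpace F' E') := by
    funext t
    change (⟨Φ.base a.1, Φ.fib a.1 (a.2 + t • b)⟩ : TotalSpace F' E') = _
    rw [map_add, map_smul]
    rfl
  rw [h]
  rfl

/-- The chain rule applied to both sides of `τ' ∘ Φ = φ ∘ τ`. -/
theorem mfderiv_proj_mfderiv_total (a : TotalSpace F E) (v : TangentSpace (totalModel n F) a) :
    mfderiv (totalModel n' F') (𝓡 n') TotalSpace.proj (Φ.total a)
        (mfderiv (totalModel n F) (totalModel n' F') Φ.total a v) =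
      mfderiv (𝓡 n) (𝓡 n') Φ.base a.1
        (mfderiv (totalModel n F) (𝓡 n) TotalSpace.proj a v) := by
  have h1 := mfderiv_comp a
    ((contMDiff_proj (IB := 𝓡 n') (n := ∞) E').contMDiffAt.mdifferentiableAt
      (x := Φ.total a) (by simp)) (Φ.mdifferentiableAt_total a)
  have h2 := mfderiv_comp a (Φ.mdifferentiableAt_base a.1)
    ((contMDiff_proj (IB := 𝓡 n) (n := ∞) E).contMDiffAt.mdifferentiableAt (x := a) (by simp))
  exact congrArg (fun T => T v) (h1.symm.trans h2)

/-- The pullback of a 1-form. -/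
def pullCovector (β : ∀ m, E' m →ₗ[ℝ] ℝ) (m : B) : E m →ₗ[ℝ] ℝ :=
  (β (Φ.base m)).comp (Φ.fib m).toLinearMap

/-- Compatibility with the anchors and with the differentials of 1-forms. -/
structure IsLowDegreeMorphism (A : LieAlgebroid n F E) (A' : LieAlgebroid n' F' E') : Prop where
  anchor : ∀ m b, A'.anchor (Φ.base m) (Φ.fib m b) =
    mfderiv (𝓡 n) (𝓡 n') Φ.base m (A.anchor m b)
  covector : ∀ β : ∀ m, E' m →ₗ[ℝ] ℝ, IsSmoothCovector n' F' β →
    ∀ (σ η : SmoothSec n F E) (σ' η' : SmoothSec n' F' E') (m : B),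
      σ' (Φ.base m) = Φ.fib m (σ m) → η' (Φ.base m) = Φ.fib m (η m) →
        A'.dCovector β σ' η' (Φ.base m) = A.dCovector (Φ.pullCovector β) σ η m

/-- Smooth functions separate tangent vectors. -/
theorem _root_.eq_of_forall_dirDeriv_eq [T2Space B] {m : B} {u v : TangentSpace (𝓡 n) m}
    (h : ∀ f : B → ℝ, ContMDiff (𝓡 n) 𝓘(ℝ, ℝ) ∞ f →
      dirDeriv (𝓡 n) f m u = dirDeriv (𝓡 n) f m v) : u = v := by
  obtain ⟨χ, -, -⟩ := (SmoothBumpFunction.nhds_basis_tsupport (I := 𝓡 n) m).mem_iff.1 Filter.univ_mem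
  -- The chart, cut off so as to be globally smooth, is unchanged near `m`. Its components are test
  -- functions that detect every coordinate of a tangent vector.
  let g : B → EuclideanSpace ℝ (Fin n) := fun x => χ x • extChartAt (𝓡 n) m x
  have hg : ContMDiff (𝓡 n) 𝓘(ℝ, EuclideanSpace ℝ (Fin n)) ∞ g :=
    χ.contMDiff_smul contMDiffOn_extChartAt
  have hgd : MDifferentiableAt (𝓡 n) 𝓘(ℝ, EuclideanSpace ℝ (Fin n)) g m :=
    (hg m).mdifferentiableAt (by simp)
  have h1 : g =ᶠ[𝓝 m] extChartAt (𝓡 n) m := by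
    filter_upwards [χ.eventuallyEq_one] with x hx
    change χ x • extChartAt (𝓡 n) m x = _
    rw [hx]
    simp
  have hinj : Function.Injective (mfderiv (𝓡 n) 𝓘(ℝ, EuclideanSpace ℝ (Fin n)) g m) := by
    rw [h1.mfderiv_eq]
    exact (isInvertible_mfderiv_extChartAt (mem_extChartAt_source m)).bijective.1
  apply hinj
  refine PiLp.ext fun i => ?_
  let ℓ : EuclideanSpace ℝ (Fin n) →L[ℝ] ℝ := EuclideanSpace.proj i
  have h2 := h (fun x => ℓ (g x)) (ℓ.contMDiff.comp hg)
  rw [dirDeriv_comp (f := ℓ) ℓ.differentiableAt.mdifferentiableAt hgd,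
    dirDeriv_comp (f := ℓ) ℓ.differentiableAt.mdifferentiableAt hgd] at h2
  unfold dirDeriv at h2
  rw [ℓ.hasMFDerivAt.mfderiv] at h2
  exact h2

variable {Φ} {A : LieAlgebroid n F E} {A' : LieAlgebroid n' F' E'}

/-- On functions, `Φ^⋆ df = d(f ∘ φ)` says that `ρ'(Φ b)` and `Tφ(ρ(b))` act equally on every smooth
`f`, so they coincide. The statement on covectors is the morphism identity in degree 1. -/
theorem IsMorphism.isLowDegreeMorphism [T2Space B] [T2Space B'] [FiniteDimensional ℝ F]
    [FiniteDimensional ℝ F'] (h : Φ.IsMorphism A A') : Φ.IsLowDegreeMorphism A A' where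
  anchor := by
    intro m b
    obtain ⟨σ, hσ⟩ := exists_smoothSec (n := n) (F := F) m b
    obtain ⟨σ', hσ'⟩ := exists_smoothSec (n := n') (F := F') (Φ.base m) (Φ.fib m b)
    refine eq_of_forall_dirDeriv_eq fun f hf => ?_
    have h1 := h 0 (fun m => AlternatingMap.constOfIsEmpty ℝ (E' m) (Fin 0) (f m))
      (fun _ => hf) (fun _ => σ) (fun _ => σ') m (fun _ => by rw [hσ, hσ'])
    rw [A'.extDiff_constOfIsEmpty] at h1
    have h2 := A.extDiff_constOfIsEmpty (fun x => f (Φ.base x)) (fun _ => σ) m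
    rw [dirDeriv_comp ((hf _).mdifferentiableAt (by simp)) (Φ.mdifferentiableAt_base m)] at h2
    rw [← hσ', ← hσ, ← h2]
    exact h1
  covector := by
    intro β hβ σ η σ' η' m hσ hη
    have h1 := h 1 (fun m => AlternatingMap.ofSubsingleton ℝ (E' m) ℝ (0 : Fin 1) (β m))
      (fun σ => hβ.contMDiff_apply (σ 0)) ![σ, η] ![σ', η'] m
      (fun i => by fin_cases i; exacts [hσ, hη])
    rw [A'.extDiff_ofSubsingleton] at h1
    refine h1.trans ?_
    exact A.extDiff_ofSubsingleton (Φ.pullCovector β) ![σ, η] m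

variable (n F E) in
/-- The identity bundle map. -/
def identity : SmoothBundleMap n F E n F E where
  base := id
  fib m := ContinuousLinearMap.id ℝ (E m)
  contMDiff_total := contMDiff_id

/-- For the identity, the condition on covectors is exactly the tensoriality of `dβ`. The pullback
formula for Cartan forms, applied to this case, then shows that `ω_L` does not depend on the
sections used to compute it. -/
theorem identity_isLowDegreeMorphism [T2Space B] [FiniteDimensional ℝ F] :
    (identity n F E).IsLowDegreeMorphism A A where
  anchor m b := by
    change A.anchor m b = mfderiv (𝓡 n) (𝓡 n) id m (A.anchor m b)
    rw [mfderiv_id]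
    rfl
  covector β hβ _ _ _ _ _ hσ hη := A.dCovector_congr hβ hσ hη

end SmoothBundleMap
end BundleMap

/-! ### The Cartan 2-form and its behaviour under pullback. -/

section CartanForm

variable {n : ℕ} {B : Type*} [TopologicalSpace B] [ChartedSpace (EuclideanSpace ℝ (Fin n)) B]
  [IsManifold (𝓡 n) ∞ B]
  {F : Type*} [NormedAddCommGroup F] [NormedSpace ℝ F]
  {E : B → Type*} [TopologicalSpace (TotalSpace F E)]
  [∀ x, AddCommGroup (E x)] [∀ x, Module ℝ (E x)] [∀ x, TopologicalSpace (E x)]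
  [FiberBundle F E] [VectorBundle ℝ F E] [ContMDiffVectorBundle ∞ F E (𝓡 n)]
  {n' : ℕ} {B' : Type*} [TopologicalSpace B'] [ChartedSpace (EuclideanSpace ℝ (Fin n')) B']
  [IsManifold (𝓡 n') ∞ B']
  {F' : Type*} [NormedAddCommGroup F'] [NormedSpace ℝ F']
  {E' : B' → Type*} [TopologicalSpace (TotalSpace F' E')]
  [∀ x, AddCommGroup (E' x)] [∀ x, Module ℝ (E' x)] [∀ x, TopologicalSpace (E' x)]
  [FiberBundle F' E'] [VectorBundle ℝ F' E'] [ContMDiffVectorBundle ∞ F' E' (𝓡 n')]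


theorem IsSmoothCovector.pullCovector {β : ∀ m, E' m →ₗ[ℝ] ℝ} (hβ : IsSmoothCovector n' F' β)
    (Φ : SmoothBundleMap n F E n' F' E') : IsSmoothCovector n F (Φ.pullCovector β) :=
  ContMDiff.comp (g := fun b : TotalSpace F' E' => β b.1 b.2) hβ Φ.contMDiff_total

theorem LieAlgebroid.extend_spec [T2Space B] [FiniteDimensional ℝ F] (A : LieAlgebroid n F E)
    {a : TotalSpace F E} (z : A.prol a) : ((A.extend z).base a.1, (A.extend z).field a) = z.1 :=
  (A.exists_projectableSec a z).choose_spec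

/-- The Cartan 2-form expressed through sections `σ`, `η` of `E` and tangent vectors `u`, `v`. -/
def LieAlgebroid.cartanOnSections (A : LieAlgebroid n F E) (L : TotalSpace F E → ℝ)
    (σ η : SmoothSec n F E) (a : TotalSpace F E) (u v : TangentSpace (totalModel n F) a) : ℝ :=
  - dirDeriv (totalModel n F) (fun y => fibreDeriv n L y (η y.1)) a u +
    dirDeriv (totalModel n F) (fun y => fibreDeriv n L y (σ y.1)) a v +
    fibreDeriv n L a (A.bracket σ η a.1)

/-- The value of `θ_L` on `(σ, X)` is the fibre derivative of `L` along `σ`, which does not see `X`.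
In Koszul's formula the bracket of vector fields therefore drops out, and the vector fields enter
only through their values at `a`. -/
theorem LieAlgebroid.cartanTwoForm_eq_onSections [T2Space B] [FiniteDimensional ℝ F]
    (A : LieAlgebroid n F E) (L : TotalSpace F E → ℝ) (a : TotalSpace F E) (z w : A.prol a) :
    A.cartanTwoForm L a z w =
      A.cartanOnSections L (A.extend z).base (A.extend w).base a z.1.2 w.1.2 := by
  have hz := congrArg Prod.snd (A.extend_spec z)
  have hw := congrArg Prod.snd (A.extend_spec w)
  rw [← hz, ← hw]
  simp [cartanTwoForm, prolExtDiff, koszulDifferential, cartanOnSections, Fin.sum_univ_two,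
    cartanOneForm, verticalEndo, fibreDeriv_apply]
  ring

theorem dirDeriv_comp_proj {f : B → ℝ} (hf : ContMDiff (𝓡 n) 𝓘(ℝ, ℝ) ∞ f) (a : TotalSpace F E)
    (u : TangentSpace (totalModel n F) a) :
    dirDeriv (totalModel n F) (fun y : TotalSpace F E => f y.1) a u =
      dirDeriv (𝓡 n) f a.1 (mfderiv (totalModel n F) (𝓡 n) TotalSpace.proj a u) :=
  dirDeriv_comp ((hf _).mdifferentiableAt (by simp))
    ((contMDiff_proj (IB := 𝓡 n) (n := ∞) E).contMDiffAt.mdifferentiableAt (by simp)) u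

namespace SmoothBundleMap

variable {Φ : SmoothBundleMap n F E n' F' E'} {A : LieAlgebroid n F E} {A' : LieAlgebroid n' F' E'}
  {L : TotalSpace F E → ℝ} {L' : TotalSpace F' E' → ℝ}

theorem fibreDeriv_comp (hL' : ContMDiff (totalModel n' F') 𝓘(ℝ, ℝ) ∞ L')
    (hLL' : ∀ a, L a = L' (Φ.total a)) (a : TotalSpace F E) (b : E a.1) :
    fibreDeriv n L a b = fibreDeriv n' L' (Φ.total a) (Φ.fib a.1 b) := by
  have h : L = fun a => L' (Φ.total a) := funext hLL'
  rw [fibreDeriv_apply, h, dirDeriv_comp ((hL' _).mdifferentiableAt (by simp))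
    (Φ.mdifferentiableAt_total a), Φ.mfderiv_total_verticalLift]
  rfl

/-- The Cartan 2-form of `L' ∘ Φ` is the pullback of that of `L'`. -/
theorem IsLowDegreeMorphism.cartanOnSections_eq [T2Space B'] [FiniteDimensional ℝ F']
    (hΦ : Φ.IsLowDegreeMorphism A A')
    (hL' : ContMDiff (totalModel n' F') 𝓘(ℝ, ℝ) ∞ L') (hLL' : ∀ a, L a = L' (Φ.total a))
    {σ η : SmoothSec n F E} {σ' η' : SmoothSec n' F' E'} {a : TotalSpace F E}
    {u v : TangentSpace (totalModel n F) a}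
    (hσ : σ' (Φ.base a.1) = Φ.fib a.1 (σ a.1)) (hη : η' (Φ.base a.1) = Φ.fib a.1 (η a.1))
    (hu : A.anchor a.1 (σ a.1) = mfderiv (totalModel n F) (𝓡 n) TotalSpace.proj a u)
    (hv : A.anchor a.1 (η a.1) = mfderiv (totalModel n F) (𝓡 n) TotalSpace.proj a v) :
    A.cartanOnSections L σ η a u v =
      A'.cartanOnSections L' σ' η' (Φ.total a)
        (mfderiv (totalModel n F) (totalModel n' F') Φ.total a u)
        (mfderiv (totalModel n F) (totalModel n' F') Φ.total a v) := by
  obtain ⟨d, e, β, c, hβ, hsum, hc⟩ :=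
    exists_cutoff_frame (n := n') (F := F') (E := E') (Φ.base a.1)
  -- Both Cartan forms are expanded in one frame of `E'` near `Φ(a)`: on the side of `E` the coframe
  -- appears pulled back by `Φ`, on the side of `E'` as it is.
  have hE : ∀ (ξ : SmoothSec n F E) (w : TangentSpace (totalModel n F) a),
      dirDeriv (totalModel n F) (fun y => fibreDeriv n L y (ξ y.1)) a w =
        ∑ i, (dirDeriv (𝓡 n) (fun x => Φ.pullCovector (β i) x (ξ x)) a.1
              (mfderiv (totalModel n F) (𝓡 n) TotalSpace.proj a w) *
            fibreDeriv n' L' (Φ.total a) (e i (Φ.total a).1) +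
          β i (Φ.base a.1) (Φ.fib a.1 (ξ a.1)) *
            dirDeriv (totalModel n' F') (fun y => fibreDeriv n' L' y (e i y.1)) (Φ.total a)
              (mfderiv (totalModel n F) (totalModel n' F') Φ.total a w)) := by
    intro ξ w
    have h1 : (fun y : TotalSpace F E => fibreDeriv n L y (ξ y.1)) =
        fun y => fibreDeriv n' L' (Φ.total y) (Φ.fib y.1 (ξ y.1)) :=
      funext fun y => fibreDeriv_comp hL' hLL' y _
    rw [h1]
    have h2 := dirDeriv_fibreDeriv_along hL' hβ hsum (G := Φ.total)
      (s := fun y : TotalSpace F E => Φ.fib y.1 (ξ y.1)) (x := a) hc (Φ.contMDiff_total a)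
      ((Φ.contMDiff_total.comp (ξ.contMDiff.comp (contMDiff_proj E))) a) w
    refine h2.trans (Finset.sum_congr rfl fun i _ => ?_)
    rw [← dirDeriv_comp_proj (((hβ i).pullCovector Φ).contMDiff_apply ξ)]
    rfl
  have hE' : ∀ (ξ' : SmoothSec n' F' E') (w : TangentSpace (totalModel n F) a),
      dirDeriv (totalModel n' F') (fun y => fibreDeriv n' L' y (ξ' y.1)) (Φ.total a)
          (mfderiv (totalModel n F) (totalModel n' F') Φ.total a w) =
        ∑ i, (dirDeriv (𝓡 n') (fun x => β i x (ξ' x)) (Φ.base a.1)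
              (mfderiv (𝓡 n) (𝓡 n') Φ.base a.1
                (mfderiv (totalModel n F) (𝓡 n) TotalSpace.proj a w)) *
            fibreDeriv n' L' (Φ.total a) (e i (Φ.total a).1) +
          β i (Φ.base a.1) (ξ' (Φ.base a.1)) *
            dirDeriv (totalModel n' F') (fun y => fibreDeriv n' L' y (e i y.1)) (Φ.total a)
              (mfderiv (totalModel n F) (totalModel n' F') Φ.total a w)) := by
    intro ξ' w
    have h2 := dirDeriv_fibreDeriv_along hL' hβ hsum (G := id)
      (s := fun y : TotalSpace F' E' => ξ' y.1) (x := Φ.total a) hc contMDiffAt_id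
      ((ξ'.contMDiff.comp (contMDiff_proj E')) (Φ.total a))
      (mfderiv (totalModel n F) (totalModel n' F') Φ.total a w)
    refine h2.trans (Finset.sum_congr rfl fun i _ => ?_)
    rw [← Φ.mfderiv_proj_mfderiv_total]
    have h3 := dirDeriv_comp_proj ((hβ i).contMDiff_apply ξ') (Φ.total a)
      (mfderiv (totalModel n F) (totalModel n' F') Φ.total a w)
    rw [mfderiv_id]
    exact congrArg₂ (· + ·) (congrArg₂ (· * ·) h3 rfl) rfl
  have hexp₀ : ∀ b' : E' (Φ.total a).1, fibreDeriv n' L' (Φ.total a) b' =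
      ∑ i, β i (Φ.total a).1 b' * fibreDeriv n' L' (Φ.total a) (e i (Φ.total a).1) := by
    intro b'
    have hc1 : c (Φ.total a).1 = 1 := hc.self_of_nhds
    have h1 := congrArg (fibreDeriv n' L' (Φ.total a)) (hsum (Φ.total a).1 b')
    rw [hc1, map_sum] at h1
    simpa using h1.symm
  have hexp : ∀ b' : E' (Φ.base a.1), fibreDeriv n' L' (Φ.total a) b' =
      ∑ i, β i (Φ.base a.1) b' * fibreDeriv n' L' (Φ.total a) (e i (Φ.total a).1) := hexp₀
  have hbr : fibreDeriv n' L' (Φ.total a) (A'.bracket σ' η' (Φ.total a).1) =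
      ∑ i, β i (Φ.base a.1) (A'.bracket σ' η' (Φ.base a.1)) *
        fibreDeriv n' L' (Φ.total a) (e i (Φ.total a).1) := hexp₀ _
  -- Since `σ'`, `η'` agree with `Φ(σ)`, `Φ(η)` at the point, the terms that differentiate `FL'(eᵢ)`
  -- match on both sides. What remains is `∑ᵢ FL'(eᵢ)` times the identity `Φ^⋆ dβᵢ = d Φ^⋆ βᵢ`.
  have hd : ∀ i, _ := fun i => hΦ.covector (β i) (hβ i) σ η σ' η' a.1 hσ hη
  unfold LieAlgebroid.dCovector at hd
  rw [hσ, hη, hΦ.anchor, hΦ.anchor, hu, hv] at hd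
  unfold LieAlgebroid.cartanOnSections
  rw [hE, hE, hE', hE', hσ, hη, fibreDeriv_comp hL' hLL', hexp, hbr,
    ← Finset.sum_neg_distrib, ← Finset.sum_neg_distrib, ← Finset.sum_add_distrib,
    ← Finset.sum_add_distrib, ← Finset.sum_add_distrib, ← Finset.sum_add_distrib]
  refine Finset.sum_congr rfl fun i _ => ?_
  have h := hd i
  change _ = _ - _ - β i (Φ.base a.1) (Φ.fib a.1 (A.bracket σ η a.1)) at h
  linear_combination (fibreDeriv n' L' (Φ.total a) (e i (Φ.total a).1)) * h

end SmoothBundleMap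
end CartanForm

/-! ### Pointwise linear algebra: the Lagrange-d'Alembert equations in one fibre. -/

section Pointwise

variable {n : ℕ} {B : Type*} [TopologicalSpace B] [ChartedSpace (EuclideanSpace ℝ (Fin n)) B]
  [IsManifold (𝓡 n) ∞ B]
  {F : Type*} [NormedAddCommGroup F] [NormedSpace ℝ F]
  {E : B → Type*} [TopologicalSpace (TotalSpace F E)]
  [∀ x, AddCommGroup (E x)] [∀ x, Module ℝ (E x)] [∀ x, TopologicalSpace (E x)]
  [FiberBundle F E] [VectorBundle ℝ F E] [ContMDiffVectorBundle ∞ F E (𝓡 n)]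
  {n' : ℕ} {B' : Type*} [TopologicalSpace B'] [ChartedSpace (EuclideanSpace ℝ (Fin n')) B']
  [IsManifold (𝓡 n') ∞ B']
  {F' : Type*} [NormedAddCommGroup F'] [NormedSpace ℝ F']
  {E' : B' → Type*} [TopologicalSpace (TotalSpace F' E')]
  [∀ x, AddCommGroup (E' x)] [∀ x, Module ℝ (E' x)] [∀ x, TopologicalSpace (E' x)]
  [FiberBundle F' E'] [VectorBundle ℝ F' E'] [ContMDiffVectorBundle ∞ F' E' (𝓡 n')]



namespace LieAlgebroid

variable {A : LieAlgebroid n F E} {L : TotalSpace F E → ℝ}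

theorem mem_prol_iff {a : TotalSpace F E} {z : E a.1 × TangentSpace (totalModel n F) a} :
    z ∈ A.prol a ↔
      A.anchor a.1 z.1 = mfderiv (totalModel n F) (𝓡 n) TotalSpace.proj a z.2 := Iff.rfl

/-- The Cartan 2-form may be computed on any sections through the given elements. -/
theorem cartanTwoForm_eq_of_sections [T2Space B] [FiniteDimensional ℝ F]
    (hL : ContMDiff (totalModel n F) 𝓘(ℝ, ℝ) ∞ L) {a : TotalSpace F E} (z w : A.prol a)
    {σ η : SmoothSec n F E} (hσ : σ a.1 = z.1.1) (hη : η a.1 = w.1.1) :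
    A.cartanTwoForm L a z w = A.cartanOnSections L σ η a z.1.2 w.1.2 := by
  have hz := congrArg Prod.fst (A.extend_spec z)
  have hw := congrArg Prod.fst (A.extend_spec w)
  rw [A.cartanTwoForm_eq_onSections]
  have h := (SmoothBundleMap.identity_isLowDegreeMorphism (A := A)).cartanOnSections_eq hL
    (fun _ => rfl) (a := a) (σ := (A.extend z).base) (η := (A.extend w).base) (σ' := σ) (η' := η)
    (u := z.1.2) (v := w.1.2) (hσ.trans hz.symm) (hη.trans hw.symm)
    (by have := z.2; rw [mem_prol_iff, ← hz] at this; exact this)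
    (by have := w.2; rw [mem_prol_iff, ← hw] at this; exact this)
  have hid : ∀ u : TangentSpace (totalModel n F) a,
      mfderiv (totalModel n F) (totalModel n F) (SmoothBundleMap.identity n F E).total a u = u := by
    intro u
    change mfderiv (totalModel n F) (totalModel n F) id a u = u
    rw [mfderiv_id]
    rfl
  rw [hid, hid] at h
  exact h

theorem cartanOnSections_skew (σ η : SmoothSec n F E) (a : TotalSpace F E)
    (u v : TangentSpace (totalModel n F) a) :
    A.cartanOnSections L σ η a u v = - A.cartanOnSections L η σ a v u := by
  unfold cartanOnSections
  rw [A.bracket_skew σ η]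
  have : (-A.bracket η σ) a.1 = -(A.bracket η σ a.1) := rfl
  rw [this, map_neg]
  ring

theorem cartanOnSections_add_smul_right (hL : ContMDiff (totalModel n F) 𝓘(ℝ, ℝ) ∞ L)
    (σ η ξ : SmoothSec n F E) (r : ℝ) (a : TotalSpace F E)
    (u v w : TangentSpace (totalModel n F) a) :
    A.cartanOnSections L σ (η + r • ξ) a u (v + r • w) =
      A.cartanOnSections L σ η a u v + r * A.cartanOnSections L σ ξ a u w := by
  have hd : ∀ ζ : SmoothSec n F E, MDifferentiableAt (totalModel n F) 𝓘(ℝ, ℝ)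
      (fun y => fibreDeriv n L y (ζ y.1)) a := fun ζ =>
    (contMDiff_fibreDeriv_section hL ζ a).mdifferentiableAt (by simp)
  have h1 : dirDeriv (totalModel n F) (fun y => fibreDeriv n L y ((η + r • ξ) y.1)) a u =
      dirDeriv (totalModel n F) (fun y => fibreDeriv n L y (η y.1)) a u +
        r * dirDeriv (totalModel n F) (fun y => fibreDeriv n L y (ξ y.1)) a u := by
    have h2 : (fun y : TotalSpace F E => fibreDeriv n L y ((η + r • ξ) y.1)) =
        (fun y => fibreDeriv n L y (η y.1)) + r • fun y => fibreDeriv n L y (ξ y.1) :=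
      funext fun y => (map_add (fibreDeriv n L y) _ _).trans
        (congrArg₂ (· + ·) rfl (map_smul (fibreDeriv n L y) _ _))
    unfold dirDeriv
    rw [h2, ((hd η).hasMFDerivAt.add ((hd ξ).hasMFDerivAt.const_smul r)).mfderiv]
    rfl
  have h3 : dirDeriv (totalModel n F) (fun y => fibreDeriv n L y (σ y.1)) a (v + r • w) =
      dirDeriv (totalModel n F) (fun y => fibreDeriv n L y (σ y.1)) a v +
        r * dirDeriv (totalModel n F) (fun y => fibreDeriv n L y (σ y.1)) a w := by
    unfold dirDeriv
    rw [map_add, map_smul]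
    rfl
  have h4 : fibreDeriv n L a (A.bracket σ (η + r • ξ) a.1) =
      fibreDeriv n L a (A.bracket σ η a.1) + r * fibreDeriv n L a (A.bracket σ ξ a.1) := by
    rw [A.bracket_add_right, A.bracket_smul_right]
    exact (map_add (fibreDeriv n L a) _ _).trans
        (congrArg₂ (· + ·) rfl (map_smul (fibreDeriv n L a) _ _))
  unfold cartanOnSections
  rw [h1, h3, h4]
  ring

variable [T2Space B] [FiniteDimensional ℝ F]

theorem cartanTwoForm_skew (hL : ContMDiff (totalModel n F) 𝓘(ℝ, ℝ) ∞ L) {a : TotalSpace F E}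
    (z w : A.prol a) : A.cartanTwoForm L a z w = - A.cartanTwoForm L a w z := by
  obtain ⟨σ, hσ⟩ := exists_smoothSec (n := n) (F := F) a.1 z.1.1
  obtain ⟨η, hη⟩ := exists_smoothSec (n := n) (F := F) a.1 w.1.1
  rw [cartanTwoForm_eq_of_sections hL z w hσ hη, cartanTwoForm_eq_of_sections hL w z hη hσ,
    cartanOnSections_skew]

/-- The chosen extensions of elements to projectable sections need not be additive, so linearity is
checked on `σ`, `η`, `ξ` and the combination `η + r ξ`, which independence of the sections permits.
-/
theorem cartanTwoForm_add_smul_right (hL : ContMDiff (totalModel n F) 𝓘(ℝ, ℝ) ∞ L)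
    {a : TotalSpace F E} (z w x : A.prol a) (r : ℝ) :
    A.cartanTwoForm L a z (w + r • x) =
      A.cartanTwoForm L a z w + r * A.cartanTwoForm L a z x := by
  obtain ⟨σ, hσ⟩ := exists_smoothSec (n := n) (F := F) a.1 z.1.1
  obtain ⟨η, hη⟩ := exists_smoothSec (n := n) (F := F) a.1 w.1.1
  obtain ⟨ξ, hξ⟩ := exists_smoothSec (n := n) (F := F) a.1 x.1.1
  have h : (η + r • ξ) a.1 = (w + r • x).1.1 := by
    change η a.1 + r • ξ a.1 = w.1.1 + r • x.1.1
    rw [hη, hξ]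
  rw [cartanTwoForm_eq_of_sections hL z w hσ hη, cartanTwoForm_eq_of_sections hL z x hσ hξ,
    cartanTwoForm_eq_of_sections hL z (w + r • x) hσ h]
  exact cartanOnSections_add_smul_right hL σ η ξ r a _ _ _

theorem cartanTwoForm_add_smul_left (hL : ContMDiff (totalModel n F) 𝓘(ℝ, ℝ) ∞ L)
    {a : TotalSpace F E} (w x z : A.prol a) (r : ℝ) :
    A.cartanTwoForm L a (w + r • x) z =
      A.cartanTwoForm L a w z + r * A.cartanTwoForm L a x z := by
  rw [cartanTwoForm_skew hL, cartanTwoForm_add_smul_right hL, cartanTwoForm_skew hL w,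
    cartanTwoForm_skew hL x]
  ring

variable (A) in
/-- The linear form `i_z ω_L - dE_L`. -/
def eulerLagrangeForm (hL : ContMDiff (totalModel n F) 𝓘(ℝ, ℝ) ∞ L) {a : TotalSpace F E}
    (z : A.prol a) : A.prol a →ₗ[ℝ] ℝ where
  toFun w := A.cartanTwoForm L a z w - A.dEnergy L a w
  map_add' w x := by
    have h1 := cartanTwoForm_add_smul_right hL z w x 1
    have h2 : A.dEnergy L a (w + x) = A.dEnergy L a w + A.dEnergy L a x :=
      map_add (mfderiv (totalModel n F) 𝓘(ℝ, ℝ) (energy n L) a) _ _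
    rw [one_smul, one_mul] at h1
    rw [h1, h2]
    ring
  map_smul' r x := by
    -- This instance reads `ω(z, 0) = ω(z, 0) + ω(z, 0)`, whence `ω(z, 0) = 0`.
    have h0 := cartanTwoForm_add_smul_right hL z 0 0 1
    have h1 := cartanTwoForm_add_smul_right hL z 0 x r
    have h2 : A.dEnergy L a (r • x) = r * A.dEnergy L a x :=
      map_smul (mfderiv (totalModel n F) 𝓘(ℝ, ℝ) (energy n L) a) _ _
    simp only [smul_zero, add_zero, one_mul, zero_add] at h0 h1
    rw [h1, h2, RingHom.id_apply, smul_eq_mul]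
    linear_combination -h0

variable (A) in
/-- The Lagrange-d'Alembert equations at `a` for the tangent space `T` of the constraint, tested
on virtual displacements. -/
def SolvesAt (L : TotalSpace F E → ℝ) (a : TotalSpace F E)
    (T : Submodule ℝ (TangentSpace (totalModel n F) a)) (z : A.prol a) : Prop :=
  ∀ w : A.prol a, verticalLift a w.1.1 ∈ T → A.cartanTwoForm L a z w = A.dEnergy L a w

/-- `S^*` maps the annihilator of a subspace onto the annihilator of its preimage under `S`. The
preimage of the elements tangent to the constraint consists of the `(b, v)` with `b` a virtual
displacement. -/
theorem mem_constraintForces_iff_solvesAt (hL : ContMDiff (totalModel n F) 𝓘(ℝ, ℝ) ∞ L)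
    {k : ℕ} {N : Type*} [TopologicalSpace N] [ChartedSpace (EuclideanSpace ℝ (Fin k)) N]
    (ι : N → TotalSpace F E) (p : N) (z : A.prol (ι p)) :
    (fun w : A.prol (ι p) => A.cartanTwoForm L (ι p) z w - A.dEnergy L (ι p) w) ∈
      A.constraintForces k ι p ↔ A.SolvesAt L (ι p) (constraintTangent k ι p) z := by
  constructor
  · rintro ⟨α, hα, h⟩ w hw
    have h1 := h w
    rw [hα _ hw] at h1
    exact sub_eq_zero.1 h1
  · intro h
    let S : A.prol (ι p) →ₗ[ℝ] A.prol (ι p) :=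
      { toFun := fun w => ⟨verticalEndo (ι p) w.1, A.verticalEndo_mem_prol (ι p) w.1⟩
        map_add' := fun w x => Subtype.ext
          (Prod.ext (add_zero _).symm (verticalLift_add (ι p) w.1.1 x.1.1))
        map_smul' := fun r x => Subtype.ext
          (Prod.ext (smul_zero _).symm (verticalLift_smul (ι p) r x.1.1)) }
    let U : Submodule ℝ (A.prol (ι p)) :=
      (constraintTangent k ι p).comap
        ((LinearMap.snd ℝ _ _).comp (A.prol (ι p)).subtype)
    -- The kernel of `S` followed by the quotient by `U` is `S⁻¹(U)`. A form vanishing there factors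
    -- through that composite, and the factor, pulled back along the quotient map, is a form
    -- vanishing on `U`.
    have h1 : A.eulerLagrangeForm hL z ∈ (LinearMap.ker (U.mkQ.comp S)).dualAnnihilator := by
      rw [Submodule.mem_dualAnnihilator]
      intro w hw
      have hw' : S w ∈ U := by
        rw [LinearMap.mem_ker, LinearMap.comp_apply] at hw
        exact (Submodule.Quotient.mk_eq_zero U).1 hw
      exact sub_eq_zero.2 (h w hw')
    rw [← LinearMap.range_dualMap_eq_dualAnnihilator_ker] at h1
    obtain ⟨α, hα⟩ := h1
    refine ⟨α.comp U.mkQ, fun w hw => ?_, fun w => ?_⟩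
    · have : U.mkQ w = 0 := (Submodule.Quotient.mk_eq_zero U).2 hw
      rw [LinearMap.comp_apply, this, map_zero]
    · exact (LinearMap.congr_fun hα w).symm

/-- The equations are affine in `z`, so the line through two solutions consists of solutions. This
is what lets solutions be blended by a bump function. -/
theorem SolvesAt.add_smul_sub (hL : ContMDiff (totalModel n F) 𝓘(ℝ, ℝ) ∞ L) {a : TotalSpace F E}
    {T : Submodule ℝ (TangentSpace (totalModel n F) a)} {z w : A.prol a} (hz : A.SolvesAt L a T z)
    (hw : A.SolvesAt L a T w) (r : ℝ) : A.SolvesAt L a T (z + r • (w + (-1 : ℝ) • z)) := by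
  intro x hx
  rw [cartanTwoForm_add_smul_left hL, cartanTwoForm_add_smul_left hL, hz x hx, hw x hx]
  ring

end LieAlgebroid

/-! ### Transfer of elements and pointwise equations along the prolongation of `Φ`. -/

namespace SmoothBundleMap

variable {Φ : SmoothBundleMap n F E n' F' E'} {A : LieAlgebroid n F E} {A' : LieAlgebroid n' F' E'}
  {L : TotalSpace F E → ℝ} {L' : TotalSpace F' E' → ℝ} {a : TotalSpace F E} {a' : TotalSpace F' E'}

theorem energy_comp (hL' : ContMDiff (totalModel n' F') 𝓘(ℝ, ℝ) ∞ L')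
    (hLL' : ∀ a, L a = L' (Φ.total a)) (a : TotalSpace F E) :
    energy n L a = energy n' L' (Φ.total a) :=
  congrArg₂ (· - ·) (fibreDeriv_comp hL' hLL' a a.2) (hLL' a)

theorem prolMap_eq_iff {z : E a.1 × TangentSpace (totalModel n F) a}
    {z' : E' (Φ.total a).1 × TangentSpace (totalModel n' F') (Φ.total a)} :
    Φ.prolMap ⟨a, z⟩ = ⟨Φ.total a, z'⟩ ↔
      Φ.fib a.1 z.1 = z'.1 ∧ mfderiv (totalModel n F) (totalModel n' F') Φ.total a z.2 = z'.2 := by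
  constructor
  · intro h
    have h1 := eq_of_heq (Sigma.mk.inj h).2
    exact ⟨congrArg Prod.fst h1, congrArg Prod.snd h1⟩
  · rintro ⟨h1, h2⟩
    exact Sigma.ext rfl (heq_of_eq (Prod.ext h1 h2))

theorem dEnergy_eq (hL' : ContMDiff (totalModel n' F') 𝓘(ℝ, ℝ) ∞ L')
    (hLL' : ∀ a, L a = L' (Φ.total a)) {w : A.prol a} {w' : A'.prol a'}
    (hw : Φ.prolMap ⟨a, w.1⟩ = ⟨a', w'.1⟩) : A.dEnergy L a w = A'.dEnergy L' a' w' := by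
  obtain rfl : Φ.total a = a' := congrArg Sigma.fst hw
  obtain ⟨-, h2⟩ := prolMap_eq_iff.1 hw
  have h : energy n L = fun y => energy n' L' (Φ.total y) :=
    funext fun y => energy_comp hL' hLL' y
  unfold LieAlgebroid.dEnergy
  rw [h, dirDeriv_comp ((contMDiff_energy hL' _).mdifferentiableAt (by simp))
    (Φ.mdifferentiableAt_total a), h2]

/-- If `Φ` is fibrewise injective, tangent vectors are determined by their images under `TΦ`
and `Tτ`. -/
theorem eq_zero_of_mfderiv_total_eq_zero (hinj : ∀ m, Function.Injective (Φ.fib m))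
    {v : TangentSpace (totalModel n F) a}
    (h1 : mfderiv (totalModel n F) (totalModel n' F') Φ.total a v = 0)
    (h2 : mfderiv (totalModel n F) (𝓡 n) TotalSpace.proj a v = 0) : v = 0 := by
  obtain ⟨b, rfl⟩ := exists_verticalLift_eq h2
  rw [Φ.mfderiv_total_verticalLift] at h1
  have h3 : verticalLift (n := n') (Φ.total a) (0 : E' (Φ.total a).1) = 0 :=
    map_zero (verticalLiftₗ n' (Φ.total a))
  have h4 : Φ.fib a.1 b = 0 := verticalLift_injective (Φ.total a) (h1.trans h3.symm)
  have h5 : b = 0 := hinj a.1 (h4.trans (map_zero _).symm)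
  rw [h5]
  exact map_zero (verticalLiftₗ n a)

variable [T2Space B] [FiniteDimensional ℝ F] [T2Space B'] [FiniteDimensional ℝ F']

/-- The extensions chosen on the two sides are related by `Φ` only at the point itself, which is all
that the comparison on sections requires. -/
theorem IsLowDegreeMorphism.cartanTwoForm_eq (hΦ : Φ.IsLowDegreeMorphism A A')
    (hL' : ContMDiff (totalModel n' F') 𝓘(ℝ, ℝ) ∞ L') (hLL' : ∀ a, L a = L' (Φ.total a))
    {z w : A.prol a} {z' w' : A'.prol a'} (hz : Φ.prolMap ⟨a, z.1⟩ = ⟨a', z'.1⟩)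
    (hw : Φ.prolMap ⟨a, w.1⟩ = ⟨a', w'.1⟩) :
    A.cartanTwoForm L a z w = A'.cartanTwoForm L' a' z' w' := by
  obtain rfl : Φ.total a = a' := congrArg Sigma.fst hz
  obtain ⟨hz1, hz2⟩ := prolMap_eq_iff.1 hz
  obtain ⟨hw1, hw2⟩ := prolMap_eq_iff.1 hw
  have e1 : (A.extend z).base a.1 = z.1.1 := congrArg Prod.fst (A.extend_spec z)
  have e2 : (A.extend w).base a.1 = w.1.1 := congrArg Prod.fst (A.extend_spec w)
  have e3 : (A'.extend z').base (Φ.base a.1) = z'.1.1 := congrArg Prod.fst (A'.extend_spec z')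
  have e4 : (A'.extend w').base (Φ.base a.1) = w'.1.1 := congrArg Prod.fst (A'.extend_spec w')
  rw [A.cartanTwoForm_eq_onSections, A'.cartanTwoForm_eq_onSections, ← hz2, ← hw2]
  refine hΦ.cartanOnSections_eq hL' hLL' ?_ ?_ ?_ ?_
  · rw [e1, e3, hz1]
  · rw [e2, e4, hw1]
  · rw [e1]; exact z.2
  · rw [e2]; exact w.2

theorem IsLowDegreeMorphism.map_mem_prol (hΦ : Φ.IsLowDegreeMorphism A A')
    {z : E a.1 × TangentSpace (totalModel n F) a} (hz : z ∈ A.prol a) :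
    ((Φ.fib a.1 z.1, mfderiv (totalModel n F) (totalModel n' F') Φ.total a z.2) :
      E' (Φ.total a).1 × TangentSpace (totalModel n' F') (Φ.total a)) ∈ A'.prol (Φ.total a) := by
  rw [LieAlgebroid.mem_prol_iff] at hz ⊢
  refine (hΦ.anchor a.1 z.1).trans ?_
  rw [hz]
  exact (Φ.mfderiv_proj_mfderiv_total a z.2).symm

theorem IsLowDegreeMorphism.exists_prolMap_eq (hΦ : Φ.IsLowDegreeMorphism A A')
    (h : Φ.total a = a') (z : A.prol a) : ∃ z' : A'.prol a', Φ.prolMap ⟨a, z.1⟩ = ⟨a', z'.1⟩ := by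
  subst h
  exact ⟨⟨_, hΦ.map_mem_prol z.2⟩, rfl⟩

/-- Compatibility of subspaces `T ⊆ T_a E` and `T' ⊆ T_{a'} E'` with `Φ`: the tangent map sends `T`
into `T'`, `T` projects onto the tangent space of the base, and `Φ` maps the elements with vertical
lift in `T` onto those with vertical lift in `T'`. -/
structure TangentCompatible (Φ : SmoothBundleMap n F E n' F' E') (a : TotalSpace F E)
    (T : Submodule ℝ (TangentSpace (totalModel n F) a)) (a' : TotalSpace F' E')
    (T' : Submodule ℝ (TangentSpace (totalModel n' F') a')) : Prop where
  total_eq : Φ.total a = a'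
  map_mem : ∀ v ∈ T, ∃ v' ∈ T',
    (⟨Φ.total a, mfderiv (totalModel n F) (totalModel n' F') Φ.total a v⟩ :
      TangentBundle (totalModel n' F') (TotalSpace F' E')) = ⟨a', v'⟩
  proj_surj : ∀ u, ∃ v ∈ T, mfderiv (totalModel n F) (𝓡 n) TotalSpace.proj a v = u
  vertical : ∀ b : E a.1, verticalLift a b ∈ T →
    ∃ b' : E' a'.1, (⟨Φ.base a.1, Φ.fib a.1 b⟩ : TotalSpace F' E') = ⟨a'.1, b'⟩ ∧
      verticalLift a' b' ∈ T'
  vertical_surj : ∀ b' : E' a'.1, verticalLift a' b' ∈ T' →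
    ∃ b : E a.1, (⟨Φ.base a.1, Φ.fib a.1 b⟩ : TotalSpace F' E') = ⟨a'.1, b'⟩ ∧
      verticalLift a b ∈ T

/-- The unconstrained case, which turns the constrained lifting lemma into fibrewise surjectivity of
the prolongation of `Φ`. -/
theorem tangentCompatible_top (hΦ_surj : ∀ m, Function.Surjective (Φ.fib m)) (a : TotalSpace F E) :
    TangentCompatible Φ a ⊤ (Φ.total a) ⊤ where
  total_eq := rfl
  map_mem _ _ := ⟨_, trivial, rfl⟩
  proj_surj u := by
    obtain ⟨v, hv⟩ := mfderiv_proj_surjective (n := n) a u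
    exact ⟨v, trivial, hv⟩
  vertical b _ := ⟨_, rfl, trivial⟩
  vertical_surj b' _ := by
    obtain ⟨b, hb⟩ := hΦ_surj a.1 b'
    exact ⟨b, by rw [hb]; rfl, trivial⟩

variable {T : Submodule ℝ (TangentSpace (totalModel n F) a)}
  {T' : Submodule ℝ (TangentSpace (totalModel n' F') a')}

/-- Elements of the prolongation with prescribed first component lift, tangentially to `T`. -/
theorem TangentCompatible.exists_lift (hΦ : Φ.IsLowDegreeMorphism A A')
    {T' : Submodule ℝ (TangentSpace (totalModel n' F') (Φ.total a))}
    (h : TangentCompatible Φ a T (Φ.total a) T') (z' : A'.prol (Φ.total a)) (hz' : z'.1.2 ∈ T')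
    {b : E a.1} (hb : Φ.fib a.1 b = z'.1.1) :
    ∃ z : A.prol a, z.1.1 = b ∧ z.1.2 ∈ T ∧ Φ.prolMap ⟨a, z.1⟩ = ⟨Φ.total a, z'.1⟩ := by
  -- Any `v` in `T` over `ρ(b)` is a first approximation. `TΦ(v)` and the second component of `z'`
  -- both lie in `T'` over the same base vector, so they differ by a vertical lift in `T'`. It lifts
  -- to a vertical lift in `T`, which is subtracted from `v`.
  obtain ⟨v, hvT, hv⟩ := h.proj_surj (A.anchor a.1 b)
  obtain ⟨v', hv'T, hv'⟩ := h.map_mem v hvT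
  obtain rfl : mfderiv (totalModel n F) (totalModel n' F') Φ.total a v = v' :=
    TotalSpace.mk_inj.1 hv'
  have h1 : mfderiv (totalModel n' F') (𝓡 n') TotalSpace.proj (Φ.total a)
      (mfderiv (totalModel n F) (totalModel n' F') Φ.total a v - z'.1.2) = 0 := by
    rw [map_sub, Φ.mfderiv_proj_mfderiv_total, hv, ← hΦ.anchor, hb]
    exact sub_eq_zero.2 (LieAlgebroid.mem_prol_iff.1 z'.2)
  obtain ⟨c', hc'⟩ := exists_verticalLift_eq h1
  obtain ⟨c, hc, hcT⟩ := h.vertical_surj c' (by rw [hc']; exact T'.sub_mem hv'T hz')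
  have hc1 : Φ.fib a.1 c = c' := TotalSpace.mk_inj.1 hc
  refine ⟨⟨(b, v - verticalLift a c), ?_⟩, rfl, T.sub_mem hvT hcT, prolMap_eq_iff.2 ⟨hb, ?_⟩⟩
  · rw [LieAlgebroid.mem_prol_iff]
    change _ = mfderiv (totalModel n F) (𝓡 n) TotalSpace.proj a (v - verticalLift a c)
    rw [map_sub, hv, mfderiv_proj_verticalLift, sub_zero]
  · change mfderiv (totalModel n F) (totalModel n' F') Φ.total a (v - verticalLift a c) = _
    rw [map_sub, Φ.mfderiv_total_verticalLift, hc1]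
    rw [hc']
    exact sub_sub_cancel _ _

theorem TangentCompatible.exists_lift_tangent (hΦ : Φ.IsLowDegreeMorphism A A')
    (hΦ_surj : ∀ m, Function.Surjective (Φ.fib m))
    (h : TangentCompatible Φ a T a' T') (z' : A'.prol a') (hz' : z'.1.2 ∈ T') :
    ∃ z : A.prol a, z.1.2 ∈ T ∧ Φ.prolMap ⟨a, z.1⟩ = ⟨a', z'.1⟩ := by
  obtain rfl := h.total_eq
  obtain ⟨b, hb⟩ := hΦ_surj a.1 z'.1.1
  obtain ⟨z, -, hz⟩ := h.exists_lift hΦ z' hz' hb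
  exact ⟨z, hz⟩

theorem TangentCompatible.exists_lift_vertical (hΦ : Φ.IsLowDegreeMorphism A A')
    (hΦ_surj : ∀ m, Function.Surjective (Φ.fib m))
    (h : TangentCompatible Φ a T a' T') (w' : A'.prol a') (hw' : verticalLift a' w'.1.1 ∈ T') :
    ∃ w : A.prol a, verticalLift a w.1.1 ∈ T ∧ Φ.prolMap ⟨a, w.1⟩ = ⟨a', w'.1⟩ := by
  obtain rfl := h.total_eq
  obtain ⟨b, hb, hbT⟩ := h.vertical_surj w'.1.1 hw'
  -- Only the first component of a test element is constrained, so its second component is lifted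
  -- without any tangency condition.
  obtain ⟨w, hwb, -, hw⟩ := (tangentCompatible_top hΦ_surj a).exists_lift hΦ w' trivial
    (TotalSpace.mk_inj.1 hb)
  exact ⟨w, by rw [hwb]; exact hbT, hw⟩

/-- Both sides of the equation are pullbacks, and the prolongation maps the test elements at `a`
onto those at `a'`. One direction lifts test elements, the other pushes them forward. -/
theorem TangentCompatible.solvesAt_iff (hΦ : Φ.IsLowDegreeMorphism A A')
    (hΦ_surj : ∀ m, Function.Surjective (Φ.fib m))
    (hL' : ContMDiff (totalModel n' F') 𝓘(ℝ, ℝ) ∞ L') (hLL' : ∀ a, L a = L' (Φ.total a))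
    (h : TangentCompatible Φ a T a' T') {z : A.prol a} {z' : A'.prol a'}
    (hz : Φ.prolMap ⟨a, z.1⟩ = ⟨a', z'.1⟩) :
    A.SolvesAt L a T z ↔ A'.SolvesAt L' a' T' z' := by
  constructor
  · intro hs w' hw'
    obtain ⟨w, hwT, hw⟩ := h.exists_lift_vertical hΦ hΦ_surj w' hw'
    rw [← hΦ.cartanTwoForm_eq hL' hLL' hz hw, ← dEnergy_eq hL' hLL' hw]
    exact hs w hwT
  · intro hs w hwT
    obtain ⟨w', hw⟩ := hΦ.exists_prolMap_eq h.total_eq w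
    rw [hΦ.cartanTwoForm_eq hL' hLL' hz hw, dEnergy_eq hL' hLL' hw]
    refine hs w' ?_
    obtain rfl := h.total_eq
    obtain ⟨b', hb', hb'T⟩ := h.vertical w.1.1 hwT
    rw [← (prolMap_eq_iff.1 hw).1]
    have : Φ.fib a.1 w.1.1 = b' := TotalSpace.mk_inj.1 hb'
    rw [this]
    exact hb'T

/-- If `L = L' ∘ Φ` is regular, then so is `L'`. -/
theorem IsLowDegreeMorphism.isRegularLagrangian (hΦ : Φ.IsLowDegreeMorphism A A')
    (hΦ_surj : ∀ m, Function.Surjective (Φ.fib m)) (hbase : Function.Surjective Φ.base)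
    (hL' : ContMDiff (totalModel n' F') 𝓘(ℝ, ℝ) ∞ L') (hLL' : ∀ a, L a = L' (Φ.total a))
    (hreg : A.IsRegularLagrangian L) : A'.IsRegularLagrangian L' := by
  rintro ⟨m', b'⟩ z' hz'
  obtain ⟨m, rfl⟩ := hbase m'
  obtain ⟨b, rfl⟩ := hΦ_surj m b'
  obtain ⟨z, -, hz⟩ := (tangentCompatible_top hΦ_surj ⟨m, b⟩).exists_lift_tangent hΦ hΦ_surj z'
    trivial
  have h0 : z = 0 := by
    refine hreg _ z fun w => ?_
    obtain ⟨w', hw⟩ := hΦ.exists_prolMap_eq rfl w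
    rw [hΦ.cartanTwoForm_eq hL' hLL' hz hw]
    exact hz' w'
  subst h0
  obtain ⟨h1, h2⟩ := prolMap_eq_iff.1 hz
  exact Subtype.ext (Prod.ext (h1.symm.trans (map_zero _)) (h2.symm.trans (map_zero _)))

/-- If `L = L' ∘ Φ` is regular, the prolongation of `Φ` is fibrewise injective. -/
theorem IsLowDegreeMorphism.prolMap_injective (hΦ : Φ.IsLowDegreeMorphism A A')
    (hL : ContMDiff (totalModel n F) 𝓘(ℝ, ℝ) ∞ L)
    (hL' : ContMDiff (totalModel n' F') 𝓘(ℝ, ℝ) ∞ L') (hLL' : ∀ a, L a = L' (Φ.total a))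
    (hreg : A.IsRegularLagrangian L) {z w : A.prol a}
    (h : Φ.prolMap ⟨a, z.1⟩ = Φ.prolMap ⟨a, w.1⟩) : z = w := by
  obtain ⟨w', hw⟩ := hΦ.exists_prolMap_eq rfl w
  -- Pairings with `ω_L` depend only on images under the prolongation, so the difference of two
  -- elements with equal image is in the kernel of `ω_L`.
  have h0 : z + (-1 : ℝ) • w = 0 := by
    refine hreg _ _ fun x => ?_
    obtain ⟨x', hx⟩ := hΦ.exists_prolMap_eq rfl x
    rw [LieAlgebroid.cartanTwoForm_add_smul_left hL, hΦ.cartanTwoForm_eq hL' hLL' hw hx,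
      hΦ.cartanTwoForm_eq hL' hLL' (h.trans hw) hx]
    ring
  exact add_neg_eq_zero.1 ((congrArg (z + ·) (neg_one_smul ℝ w)).symm.trans h0)

/-- The prolongation sends the vertical element `(0, b^V)` to `(0, (Φ b)^V)`, so its injectivity
forces that of `Φ` on fibres. Any base point in the fibre would do, and the zero vector is used. -/
theorem IsLowDegreeMorphism.fib_injective (hΦ : Φ.IsLowDegreeMorphism A A')
    (hL : ContMDiff (totalModel n F) 𝓘(ℝ, ℝ) ∞ L)
    (hL' : ContMDiff (totalModel n' F') 𝓘(ℝ, ℝ) ∞ L') (hLL' : ∀ a, L a = L' (Φ.total a))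
    (hreg : A.IsRegularLagrangian L) (m : B) : Function.Injective (Φ.fib m) := by
  intro b c hbc
  let a : TotalSpace F E := ⟨m, 0⟩
  have h := hΦ.prolMap_injective hL hL' hLL' hreg (a := a)
    (z := ⟨_, A.verticalEndo_mem_prol a (b, 0)⟩) (w := ⟨_, A.verticalEndo_mem_prol a (c, 0)⟩)
    (prolMap_eq_iff.2 ⟨rfl, by
      refine (Φ.mfderiv_total_verticalLift a b).trans
        (Eq.trans ?_ (Φ.mfderiv_total_verticalLift a c).symm)
      exact congrArg (verticalLift (Φ.total a)) hbc⟩)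
  exact verticalLift_injective a (congrArg (fun z : A.prol a => z.1.2) h)

end SmoothBundleMap
end Pointwise

/-! ### Smooth constrained sections and the correspondence of solutions. -/

section ConstrainedSystems

variable {n : ℕ} {B : Type*} [TopologicalSpace B] [ChartedSpace (EuclideanSpace ℝ (Fin n)) B]
  [IsManifold (𝓡 n) ∞ B]
  {F : Type*} [NormedAddCommGroup F] [NormedSpace ℝ F]
  {E : B → Type*} [TopologicalSpace (TotalSpace F E)]
  [∀ x, AddCommGroup (E x)] [∀ x, Module ℝ (E x)] [∀ x, TopologicalSpace (E x)]
  [FiberBundle F E] [VectorBundle ℝ F E] [ContMDiffVectorBundle ∞ F E (𝓡 n)]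
  {n' : ℕ} {B' : Type*} [TopologicalSpace B'] [ChartedSpace (EuclideanSpace ℝ (Fin n')) B']
  [IsManifold (𝓡 n') ∞ B']
  {F' : Type*} [NormedAddCommGroup F'] [NormedSpace ℝ F']
  {E' : B' → Type*} [TopologicalSpace (TotalSpace F' E')]
  [∀ x, AddCommGroup (E' x)] [∀ x, Module ℝ (E' x)] [∀ x, TopologicalSpace (E' x)]
  [FiberBundle F' E'] [VectorBundle ℝ F' E'] [ContMDiffVectorBundle ∞ F' E' (𝓡 n')]
  {k : ℕ} {N : Type*} [TopologicalSpace N] [ChartedSpace (EuclideanSpace ℝ (Fin k)) N]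
  [IsManifold (𝓡 k) ∞ N]
  {k' : ℕ} {N' : Type*} [TopologicalSpace N'] [ChartedSpace (EuclideanSpace ℝ (Fin k')) N']
  [IsManifold (𝓡 k') ∞ N']

/-- The component in `E` of an element of the prolongation. -/
def prolFst (z : Σ a : TotalSpace F E, E a.1 × TangentSpace (totalModel n F) a) : TotalSpace F E :=
  ⟨z.1.1, z.2.1⟩

/-- The component in `TE` of an element of the prolongation. -/
def prolSnd (z : Σ a : TotalSpace F E, E a.1 × TangentSpace (totalModel n F) a) :
    TangentBundle (totalModel n F) (TotalSpace F E) :=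
  ⟨z.1, z.2.2⟩

namespace SmoothBundleMap

variable {Φ : SmoothBundleMap n F E n' F' E'} {A : LieAlgebroid n F E} {A' : LieAlgebroid n' F' E'}
  {L : TotalSpace F E → ℝ} {L' : TotalSpace F' E' → ℝ} {ι : N → TotalSpace F E}
  {ι' : N' → TotalSpace F' E'} {ψ : N → N'}

theorem contMDiff_tangentMap_total : ContMDiff (totalModel n F).tangent (totalModel n' F').tangent ∞
    (tangentMap (totalModel n F) (totalModel n' F') Φ.total) :=
  ContMDiff.contMDiff_tangentMap (n := ∞) Φ.contMDiff_total (by simp)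

/-- A section of the prolongation along `f` is smooth if its image under a fibrewise injective
morphism is smooth. -/
theorem contMDiffAt_of_prolMap {EP HP P : Type*} [NormedAddCommGroup EP] [NormedSpace ℝ EP]
    [TopologicalSpace HP] {I : ModelWithCorners ℝ EP HP} [TopologicalSpace P] [ChartedSpace HP P]
    [FiniteDimensional ℝ F] [FiniteDimensional ℝ F'] (hinj : ∀ m, Function.Injective (Φ.fib m))
    {f : P → TotalSpace F E} {z : ∀ p, A.prol (f p)} {p₀ : P}
    (hf : ContMDiffAt I (totalModel n F) ∞ f p₀)
    (h1 : ContMDiffAt I (totalModel n' F') ∞ (fun p => prolFst (Φ.prolMap ⟨f p, (z p).1⟩)) p₀)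
    (h2 : ContMDiffAt I (totalModel n' F').tangent ∞
      (fun p => prolSnd (Φ.prolMap ⟨f p, (z p).1⟩)) p₀) :
    ContMDiffAt I (totalModel n F) ∞
        (fun p => (⟨(f p).1, (z p).1.1⟩ : TotalSpace F E)) p₀ ∧
      ContMDiffAt I (totalModel n F).tangent ∞
        (fun p => (⟨f p, (z p).1.2⟩ : TangentBundle (totalModel n F) (TotalSpace F E))) p₀ := by
  have hp : ContMDiffAt I (𝓡 n) ∞ (fun p => (f p).1) p₀ :=
    (contMDiff_proj E).contMDiffAt.comp p₀ hf
  have hfst : ContMDiffAt I (totalModel n F) ∞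
      (fun p => (⟨(f p).1, (z p).1.1⟩ : TotalSpace F E)) p₀ :=
    contMDiffAt_of_injective_bundleMap (IB := 𝓡 n) (IB' := 𝓡 n') Φ.fib Φ.contMDiff_total hp
      (hinj _) h1
  refine ⟨hfst, ?_⟩
  -- Membership in the prolongation identifies the projected velocity with the anchor of the first
  -- component, already known to be smooth.
  have h3 : ContMDiffAt I (𝓡 n).tangent ∞ (fun p => (⟨(f p).1,
      mfderiv (totalModel n F) (𝓡 n) TotalSpace.proj (f p) (z p).1.2⟩ :
        TangentBundle (𝓡 n) B)) p₀ := by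
    refine (A.contMDiff_anchor.contMDiffAt.comp p₀ hfst).congr_of_eventuallyEq
      (Filter.Eventually.of_forall fun p => ?_)
    exact congrArg (TotalSpace.mk (f p).1) (LieAlgebroid.mem_prol_iff.1 (z p).2).symm
  -- `TΦ` may have a kernel coming from that of `Tφ`. Adding the projection to `B` gives a map `(Φ,
  -- τ)` with injective tangent maps, so smoothness of `TΦ(v)` and `Tτ(v)` yields smoothness of `v`.
  let g : TotalSpace F E → TotalSpace F' E' × B := fun a => (Φ.total a, a.1)
  have hτ : ContMDiff (totalModel n F) (𝓡 n) ∞ (TotalSpace.proj : TotalSpace F E → B) :=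
    contMDiff_proj E
  have hg : ContMDiff (totalModel n F) ((totalModel n' F').prod (𝓡 n)) ∞ g :=
    Φ.contMDiff_total.prodMk hτ
  have hdg : ∀ (a : TotalSpace F E) (v : TangentSpace (totalModel n F) a),
      (mfderiv (totalModel n F) ((totalModel n' F').prod (𝓡 n)) g a v :
          (EuclideanSpace ℝ (Fin n') × F') × EuclideanSpace ℝ (Fin n)) =
        (mfderiv (totalModel n F) (totalModel n' F') Φ.total a v,
          mfderiv (totalModel n F) (𝓡 n) TotalSpace.proj a v) := by
    intro a v
    have h := (Φ.mdifferentiableAt_total a).hasMFDerivAt.prodMk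
      ((hτ a).mdifferentiableAt (by simp)).hasMFDerivAt
    exact congrArg (fun T => T v) h.mfderiv
  refine contMDiffAt_of_injective_bundleMap (IB := totalModel n F)
    (IB' := (totalModel n' F').prod (𝓡 n))
    (E := fun a : TotalSpace F E => TangentSpace (totalModel n F) a)
    (E' := fun b : TotalSpace F' E' × B => TangentSpace ((totalModel n' F').prod (𝓡 n)) b)
    (g := g) (fun a => mfderiv (totalModel n F) ((totalModel n' F').prod (𝓡 n)) g a)
    (hg.contMDiff_tangentMap (m := ∞) (by simp)) hf ?_ ?_
  · rw [injective_iff_map_eq_zero]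
    intro v hv
    have h := (hdg (f p₀) v).symm.trans hv
    exact eq_zero_of_mfderiv_total_eq_zero hinj (congrArg Prod.fst h) (congrArg Prod.snd h)
  · refine ((contMDiff_equivTangentBundleProd_symm (I := totalModel n' F')
      (M := TotalSpace F' E') (I' := 𝓡 n) (M' := B)).contMDiffAt.comp p₀
        (h2.prodMk h3)).congr_of_eventuallyEq (Filter.Eventually.of_forall fun p => ?_)
    exact congrArg (TotalSpace.mk (g (f p))) (hdg (f p) (z p).1.2)

/-- Tangent vectors are carried over by differentiating `Φ ∘ ι = ι' ∘ ψ`, surjectivity onto the base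
directions holds because `τ ∘ ι` is a submersion, and the two vertical conditions are the two
inclusions in (iii). -/
theorem tangentCompatible_constraint (hι : IsConstraintSubmanifold n k ι)
    (hι' : IsConstraintSubmanifold n' k' ι') (hψ : ∀ p, ι' (ψ p) = Φ.total (ι p))
    (hψ_sub : IsSubmersion (𝓡 k) (𝓡 k') ∞ ψ)
    (hV : ∀ p, Φ.total '' virtualDisplacements n k ι p = virtualDisplacements n' k' ι' (ψ p))
    (p : N) :
    TangentCompatible Φ (ι p) (constraintTangent k ι p) (ι' (ψ p))
      (constraintTangent k' ι' (ψ p)) where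
  total_eq := (hψ p).symm
  map_mem := by
    rintro _ ⟨u, rfl⟩
    have hι1 : MDifferentiableAt (𝓡 k) (totalModel n F) ι p :=
      (hι.isSmoothEmbedding.contMDiff p).mdifferentiableAt (by simp)
    have hι1' : MDifferentiableAt (𝓡 k') (totalModel n' F') ι' (ψ p) :=
      (hι'.isSmoothEmbedding.contMDiff _).mdifferentiableAt (by simp)
    have hψ1 : MDifferentiableAt (𝓡 k) (𝓡 k') ψ p :=
      (hψ_sub.contMDiff p).mdifferentiableAt (by simp)
    refine ⟨mfderiv (𝓡 k') (totalModel n' F') ι' (ψ p) (mfderiv (𝓡 k) (𝓡 k') ψ p u),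
      ⟨_, rfl⟩, ?_⟩
    -- The comparison is made in the tangent bundle because the base points `Φ(ι p)` and `ι'(ψ p)`
    -- are equal only propositionally.
    have h1 := tangentMap_comp_at (I'' := totalModel n' F') (⟨p, u⟩ : TangentBundle (𝓡 k) N)
      (Φ.mdifferentiableAt_total (ι p)) hι1
    have h2 := tangentMap_comp_at (I'' := totalModel n' F') (⟨p, u⟩ : TangentBundle (𝓡 k) N)
      hι1' hψ1
    have h3 : Φ.total ∘ ι = ι' ∘ ψ := funext fun p => (hψ p).symm
    rw [h3] at h1
    exact h1.symm.trans h2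
  proj_surj := by
    intro u
    have hc : ContMDiff (𝓡 k) (𝓡 n) ∞ (fun p => (ι p).1) :=
      (contMDiff_proj E).comp hι.isSmoothEmbedding.contMDiff
    obtain ⟨w, hw⟩ := hι.isSubmersion_proj.mfderiv_surjective (by simp) hc p u
    refine ⟨_, ⟨w, rfl⟩, ?_⟩
    have h := mfderiv_comp p
      ((contMDiff_proj (IB := 𝓡 n) (n := ∞) E).contMDiffAt.mdifferentiableAt
        (x := ι p) (by simp))
      ((hι.isSmoothEmbedding.contMDiff p).mdifferentiableAt (by simp))
    exact (congrArg (fun T => T w) h).symm.trans hw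
  vertical := by
    intro b hb
    have h : Φ.total ⟨(ι p).1, b⟩ ∈ virtualDisplacements n' k' ι' (ψ p) := by
      rw [← hV p]
      exact ⟨_, ⟨b, rfl, hb⟩, rfl⟩
    exact h
  vertical_surj := by
    intro b' hb'
    have h : (⟨(ι' (ψ p)).1, b'⟩ : TotalSpace F' E') ∈ Φ.total '' virtualDisplacements n k ι p := by
      rw [hV p]
      exact ⟨b', rfl, hb'⟩
    obtain ⟨_, ⟨b, rfl, hb⟩, h2⟩ := h
    exact ⟨b, h2, hb⟩

theorem TangentCompatible.map_tangent {a : TotalSpace F E} {a' : TotalSpace F' E'}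
    {T : Submodule ℝ (TangentSpace (totalModel n F) a)}
    {T' : Submodule ℝ (TangentSpace (totalModel n' F') a')} (h : TangentCompatible Φ a T a' T')
    {z : A.prol a} {z' : A'.prol a'} (hz : z.1.2 ∈ T) (hzz' : Φ.prolMap ⟨a, z.1⟩ = ⟨a', z'.1⟩) :
    z'.1.2 ∈ T' := by
  obtain rfl := h.total_eq
  obtain ⟨v', hv', h1⟩ := h.map_mem _ hz
  rw [← (prolMap_eq_iff.1 hzz').2]
  have h2 := TotalSpace.mk_inj.1 h1
  rw [h2]
  exact hv'

variable [T2Space B] [FiniteDimensional ℝ F] [T2Space B'] [FiniteDimensional ℝ F']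

theorem _root_.LieAlgebroid.ConstrainedSec.isSolution_iff
    (hL : ContMDiff (totalModel n F) 𝓘(ℝ, ℝ) ∞ L) (Γ : A.ConstrainedSec k ι) :
    Γ.IsSolution L ↔ ∀ p, A.SolvesAt L (ι p) (constraintTangent k ι p) (Γ.val p) :=
  forall_congr' fun p => LieAlgebroid.mem_constraintForces_iff_solvesAt hL ι p (Γ.val p)

/-- A constrained section is determined by its values. -/
theorem _root_.LieAlgebroid.ConstrainedSec.ext_val {Γ₁ Γ₂ : A.ConstrainedSec k ι}
    (h : ∀ p, Γ₁.val p = Γ₂.val p) : Γ₁ = Γ₂ := by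
  obtain ⟨v, _, _, _⟩ := Γ₁
  obtain ⟨w, _, _, _⟩ := Γ₂
  obtain rfl : v = w := funext h
  rfl

theorem contMDiff_prolFst_prolMap (Γ : A.ConstrainedSec k ι) :
    ContMDiff (𝓡 k) (totalModel n' F') ∞
      (fun p => prolFst (Φ.prolMap ⟨ι p, (Γ.val p).1⟩)) :=
  Φ.contMDiff_total.comp Γ.contMDiff_fst

theorem contMDiff_prolSnd_prolMap (Γ : A.ConstrainedSec k ι) :
    ContMDiff (𝓡 k) (totalModel n' F').tangent ∞
      (fun p => prolSnd (Φ.prolMap ⟨ι p, (Γ.val p).1⟩)) :=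
  Φ.contMDiff_tangentMap_total.comp Γ.contMDiff_snd

/-! ### Lifting and descending solutions. -/

section Correspondence

variable (hcompat : ∀ p, TangentCompatible Φ (ι p) (constraintTangent k ι p) (ι' (ψ p))
    (constraintTangent k' ι' (ψ p)))
  (hΦ : Φ.IsLowDegreeMorphism A A') (hΦ_surj : ∀ m, Function.Surjective (Φ.fib m))
  (hL : ContMDiff (totalModel n F) 𝓘(ℝ, ℝ) ∞ L)
  (hL' : ContMDiff (totalModel n' F') 𝓘(ℝ, ℝ) ∞ L') (hLL' : ∀ a, L a = L' (Φ.total a))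
  (hLreg : A.IsRegularLagrangian L)

include hcompat hΦ hΦ_surj hL' hLL' in
/-- Pointwise solutions lift along `Φ`. -/
theorem exists_solvesAt_lift (p : N) (z' : A'.prol (ι' (ψ p)))
    (hz'T : z'.1.2 ∈ constraintTangent k' ι' (ψ p))
    (hz' : A'.SolvesAt L' (ι' (ψ p)) (constraintTangent k' ι' (ψ p)) z') :
    ∃ z : A.prol (ι p), z.1.2 ∈ constraintTangent k ι p ∧
      A.SolvesAt L (ι p) (constraintTangent k ι p) z ∧
      Φ.prolMap ⟨ι p, z.1⟩ = ⟨ι' (ψ p), z'.1⟩ := by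
  obtain ⟨z, hzT, hz⟩ := (hcompat p).exists_lift_tangent hΦ hΦ_surj z' hz'T
  exact ⟨z, hzT, ((hcompat p).solvesAt_iff hΦ hΦ_surj hL' hLL' hz).2 hz', hz⟩

include hcompat hΦ hΦ_surj hL' hLL' in
/-- Pointwise solutions are mapped to pointwise solutions. -/
theorem exists_solvesAt_map {p : N} {q : N'} (hpq : ψ p = q) (z : A.prol (ι p))
    (hzT : z.1.2 ∈ constraintTangent k ι p)
    (hz : A.SolvesAt L (ι p) (constraintTangent k ι p) z) :
    ∃ z' : A'.prol (ι' q), z'.1.2 ∈ constraintTangent k' ι' q ∧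
      A'.SolvesAt L' (ι' q) (constraintTangent k' ι' q) z' ∧
      Φ.prolMap ⟨ι p, z.1⟩ = ⟨ι' q, z'.1⟩ := by
  subst hpq
  obtain ⟨z', hz'⟩ := hΦ.exists_prolMap_eq (hcompat p).total_eq z
  exact ⟨z', (hcompat p).map_tangent hzT hz',
    ((hcompat p).solvesAt_iff hΦ hΦ_surj hL' hLL' hz').1 hz, hz'⟩

include hcompat hΦ hΦ_surj hL hL' hLL' hLreg in
/-- Every solution of the reduced system lifts to a solution. -/
theorem exists_isSolution_lift (hι : ContMDiff (𝓡 k) (totalModel n F) ∞ ι)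
    (hψ : ContMDiff (𝓡 k) (𝓡 k') ∞ ψ) (Γ' : A'.ConstrainedSec k' ι') (hΓ' : Γ'.IsSolution L') :
    ∃ Γ : A.ConstrainedSec k ι, Γ.IsSolution L ∧
      ∀ p, Φ.prolMap ⟨ι p, (Γ.val p).1⟩ = ⟨ι' (ψ p), (Γ'.val (ψ p)).1⟩ := by
  rw [Γ'.isSolution_iff hL'] at hΓ'
  choose z hzT hz hzΦ using fun p => exists_solvesAt_lift hcompat hΦ hΦ_surj hL' hLL' p
    (Γ'.val (ψ p)) (Γ'.tangent _) (hΓ' _)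
  -- The lifts are chosen point by point. They are nevertheless smooth, since their image is the
  -- smooth section `Γ' ∘ ψ`.
  have hsm := fun p => contMDiffAt_of_prolMap (A := A) (Φ := Φ) (z := z)
    (hΦ.fib_injective hL hL' hLL' hLreg) (hι p)
    (by simp_rw [hzΦ]; exact (Γ'.contMDiff_fst.comp hψ) p)
    (by simp_rw [hzΦ]; exact (Γ'.contMDiff_snd.comp hψ) p)
  let Γ : A.ConstrainedSec k ι := ⟨z, hzT, fun p => (hsm p).1, fun p => (hsm p).2⟩
  exact ⟨Γ, (Γ.isSolution_iff hL).2 hz, hzΦ⟩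

include hcompat hΦ hΦ_surj hL hL' hLL' hLreg in
/-- The image of the unique solution is constant on the fibres of `ψ`. -/
theorem prolMap_eq_of_unique [T2Space N'] (hι : ContMDiff (𝓡 k) (totalModel n F) ∞ ι)
    (hψ_surj : Function.Surjective ψ) (hψ : IsSubmersion (𝓡 k) (𝓡 k') ∞ ψ)
    (Γ : A.ConstrainedSec k ι) (hΓ : Γ.IsSolution L)
    (huniq : ∀ Γ₁ : A.ConstrainedSec k ι, Γ₁.IsSolution L → Γ₁ = Γ) {p₁ p₂ : N}
    (hp : ψ p₁ = ψ p₂) :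
    Φ.prolMap ⟨ι p₁, (Γ.val p₁).1⟩ = Φ.prolMap ⟨ι p₂, (Γ.val p₂).1⟩ := by
  classical
  have hΓ₀ := (Γ.isSolution_iff hL).1 hΓ
  have hψc : ContMDiff (𝓡 k) (𝓡 k') ∞ ψ := hψ.contMDiff
  obtain ⟨U, s, hU, hpU, hs, hsp, hψs⟩ := hψ.exists_local_section p₁
  -- A right inverse of `ψ`, smooth on `U` and passing through `p₁`. Its values outside `U` play no
  -- role, because the bump function vanishes there.
  let r : N' → N := fun q => if q ∈ U then s q else (hψ_surj q).choose
  have hr : ∀ q, ψ (r q) = q := by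
    intro q
    by_cases hq : q ∈ U
    · simp only [r, if_pos hq]; exact hψs q hq
    · simp only [r, if_neg hq]; exact (hψ_surj q).choose_spec
  have hrs : ∀ q ∈ U, r q = s q := fun q hq => if_pos hq
  -- `z` is `Γ` transported along the fibres of `ψ`: the value at `r (ψ p)` is pushed down to `ι' (ψ
  -- p)` and lifted again at `p`.
  have hex : ∀ p, ∃ z : A.prol (ι p), z.1.2 ∈ constraintTangent k ι p ∧
      A.SolvesAt L (ι p) (constraintTangent k ι p) z ∧
      Φ.prolMap ⟨ι p, z.1⟩ = Φ.prolMap ⟨ι (r (ψ p)), (Γ.val (r (ψ p))).1⟩ := by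
    intro p
    obtain ⟨z', hz'T, hz', h1⟩ := exists_solvesAt_map hcompat hΦ hΦ_surj hL' hLL' (hr (ψ p))
      (Γ.val (r (ψ p))) (Γ.tangent _) (hΓ₀ _)
    obtain ⟨z, hzT, hz, h2⟩ := exists_solvesAt_lift hcompat hΦ hΦ_surj hL' hLL' p z' hz'T hz'
    exact ⟨z, hzT, hz, h2.trans h1.symm⟩
  choose z hzT hz hzΦ using hex
  have hzsm : ∀ p, ψ p ∈ U →
      ContMDiffAt (𝓡 k) (totalModel n F) ∞
          (fun p => (⟨(ι p).1, (z p).1.1⟩ : TotalSpace F E)) p ∧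
        ContMDiffAt (𝓡 k) (totalModel n F).tangent ∞
          (fun p => (⟨ι p, (z p).1.2⟩ : TangentBundle (totalModel n F) (TotalSpace F E))) p := by
    intro p hpU
    have hsψ : ContMDiffAt (𝓡 k) (𝓡 k) ∞ (fun p => s (ψ p)) p :=
      ((hs _ hpU).contMDiffAt (hU.mem_nhds hpU)).comp p (hψc p)
    have hev : ∀ᶠ x in 𝓝 p, Φ.prolMap ⟨ι x, (z x).1⟩ =
        Φ.prolMap ⟨ι (s (ψ x)), (Γ.val (s (ψ x))).1⟩ := by
      filter_upwards [hψc.continuous.continuousAt.eventually (hU.mem_nhds hpU)] with x hx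
      rw [hzΦ, hrs _ hx]
    refine contMDiffAt_of_prolMap (Φ := Φ) (hΦ.fib_injective hL hL' hLL' hLreg) (hι p) ?_ ?_
    · have h := (contMDiff_prolFst_prolMap (Φ := Φ) Γ (s (ψ p))).comp p hsψ
      exact h.congr_of_eventuallyEq (hev.mono fun x hx => congrArg prolFst hx)
    · have h := (contMDiff_prolSnd_prolMap (Φ := Φ) Γ (s (ψ p))).comp p hsψ
      exact h.congr_of_eventuallyEq (hev.mono fun x hx => congrArg prolSnd hx)
  obtain ⟨χ, -, hχ⟩ := (SmoothBumpFunction.nhds_basis_tsupport (I := 𝓡 k') (ψ p₁)).mem_iff.1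
    (hU.mem_nhds hpU)
  have hχψ : ContMDiff (𝓡 k) 𝓘(ℝ, ℝ) ∞ (fun p => χ (ψ p)) := χ.contMDiff.comp hψc
  -- The blend `Γ + χ(ψ)(z - Γ)` is a globally smooth solution, hence equals `Γ`. At `p₂` the bump
  -- function is `1`, so the transported value there is `Γ` itself.
  let v : ∀ p, A.prol (ι p) := fun p => Γ.val p + χ (ψ p) • (z p + (-1 : ℝ) • Γ.val p)
  have hvsm : ∀ p,
      ContMDiffAt (𝓡 k) (totalModel n F) ∞
          (fun p => (⟨(ι p).1, (v p).1.1⟩ : TotalSpace F E)) p ∧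
        ContMDiffAt (𝓡 k) (totalModel n F).tangent ∞
          (fun p => (⟨ι p, (v p).1.2⟩ : TangentBundle (totalModel n F) (TotalSpace F E))) p := by
    intro p
    by_cases hpU : ψ p ∈ U
    · obtain ⟨h1, h2⟩ := hzsm p hpU
      exact ⟨contMDiffAt_add_smul_along (Γ.contMDiff_fst p)
          (contMDiffAt_add_smul_along h1 (Γ.contMDiff_fst p) contMDiffAt_const) (hχψ p),
        contMDiffAt_add_smul_along (Γ.contMDiff_snd p)
          (contMDiffAt_add_smul_along h2 (Γ.contMDiff_snd p) contMDiffAt_const) (hχψ p)⟩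
    · have hev : ∀ᶠ x in 𝓝 p, v x = Γ.val x := by
        have h1 : ψ ⁻¹' (tsupport χ)ᶜ ∈ 𝓝 p :=
          hψc.continuous.continuousAt.preimage_mem_nhds
            ((isClosed_tsupport χ).isOpen_compl.mem_nhds fun h => hpU (hχ h))
        filter_upwards [h1] with x hx
        have h2 : χ (ψ x) = 0 := image_eq_zero_of_notMem_tsupport hx
        change Γ.val x + χ (ψ x) • _ = _
        rw [h2, zero_smul, add_zero]
      exact ⟨(Γ.contMDiff_fst p).congr_of_eventuallyEq (hev.mono fun x hx => by simp only [hx]),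
        (Γ.contMDiff_snd p).congr_of_eventuallyEq (hev.mono fun x hx => by simp only [hx])⟩
  let Γ₁ : A.ConstrainedSec k ι :=
    { val := v
      tangent := fun p => Submodule.add_mem _ (Γ.tangent p) (Submodule.smul_mem _ _
        (Submodule.add_mem _ (hzT p) (Submodule.smul_mem _ _ (Γ.tangent p))))
      contMDiff_fst := fun p => (hvsm p).1
      contMDiff_snd := fun p => (hvsm p).2 }
  have hΓ₁ : Γ₁ = Γ := huniq Γ₁ ((Γ₁.isSolution_iff hL).2 fun p =>
    (hΓ₀ p).add_smul_sub hL (hz p) _)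
  have h2 : v p₂ = Γ.val p₂ := congrArg (fun Γ : A.ConstrainedSec k ι => Γ.val p₂) hΓ₁
  have h3 : χ (ψ p₂) = 1 := by rw [← hp]; exact χ.eq_one
  have h4 : z p₂ = Γ.val p₂ := by
    change Γ.val p₂ + χ (ψ p₂) • (z p₂ + (-1 : ℝ) • Γ.val p₂) = _ at h2
    rw [h3, one_smul, add_eq_left] at h2
    exact add_neg_eq_zero.1 ((congrArg (z p₂ + ·) (neg_one_smul ℝ (Γ.val p₂))).symm.trans h2)
  have h5 : r (ψ p₂) = p₁ := by rw [← hp, hrs _ hpU, hsp]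
  have h6 := hzΦ p₂
  rw [h4, h5] at h6
  exact h6.symm

include hcompat hΦ hΦ_surj hL hL' hLL' hLreg in
/-- The image of the unique solution is a solution of the reduced system. -/
theorem exists_isSolution_map [T2Space N'] (hι : ContMDiff (𝓡 k) (totalModel n F) ∞ ι)
    (hψ_surj : Function.Surjective ψ) (hψ : IsSubmersion (𝓡 k) (𝓡 k') ∞ ψ)
    (Γ : A.ConstrainedSec k ι) (hΓ : Γ.IsSolution L)
    (huniq : ∀ Γ₁ : A.ConstrainedSec k ι, Γ₁.IsSolution L → Γ₁ = Γ) :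
    ∃ Γ' : A'.ConstrainedSec k' ι', Γ'.IsSolution L' := by
  have hΓ₀ := (Γ.isSolution_iff hL).1 hΓ
  choose r hr using hψ_surj
  choose z hzT hz hzΦ using fun q => exists_solvesAt_map hcompat hΦ hΦ_surj hL' hLL' (hr q)
    (Γ.val (r q)) (Γ.tangent _) (hΓ₀ _)
  -- The right inverse `r` is arbitrary, but constancy on the fibres of `ψ` allows it to be replaced
  -- near each `q` by a smooth local section, giving smoothness of the descended section.
  have hloc : ∀ q, ∃ s : N' → N, ContMDiffAt (𝓡 k') (𝓡 k) ∞ s q ∧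
      ∀ᶠ x in 𝓝 q, (⟨ι' x, (z x).1⟩ :
        Σ a : TotalSpace F' E', E' a.1 × TangentSpace (totalModel n' F') a) =
          Φ.prolMap ⟨ι (s x), (Γ.val (s x)).1⟩ := by
    intro q
    obtain ⟨U, s, hU, hqU, hs, -, hψs⟩ := hψ.exists_local_section (r q)
    rw [hr] at hqU
    refine ⟨s, (hs _ hqU).contMDiffAt (hU.mem_nhds hqU), ?_⟩
    filter_upwards [hU.mem_nhds hqU] with x hx
    rw [← hzΦ]
    exact prolMap_eq_of_unique hcompat hΦ hΦ_surj hL hL' hLL' hLreg hι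
      (fun q => ⟨r q, hr q⟩) hψ Γ hΓ huniq ((hr x).trans (hψs x hx).symm)
  let Γ' : A'.ConstrainedSec k' ι' :=
    { val := z
      tangent := hzT
      contMDiff_fst := fun q => by
        obtain ⟨s, hs, hev⟩ := hloc q
        have h := (contMDiff_prolFst_prolMap (Φ := Φ) Γ (s q)).comp q hs
        exact h.congr_of_eventuallyEq (hev.mono fun x hx => congrArg prolFst hx)
      contMDiff_snd := fun q => by
        obtain ⟨s, hs, hev⟩ := hloc q
        have h := (contMDiff_prolSnd_prolMap (Φ := Φ) Γ (s q)).comp q hs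
        exact h.congr_of_eventuallyEq (hev.mono fun x hx => congrArg prolSnd hx) }
  exact ⟨Γ', (Γ'.isSolution_iff hL').2 hz⟩

/-- Trajectories are mapped to trajectories by a map intertwining the dynamics. -/
theorem isTrajectory_map {Γ : A.ConstrainedSec k ι} {Γ' : A'.ConstrainedSec k' ι'}
    (h : ∀ p, Φ.prolMap ⟨ι p, (Γ.val p).1⟩ = ⟨ι' (ψ p), (Γ'.val (ψ p)).1⟩) {s : Set ℝ}
    {c : ℝ → TotalSpace F E} (hc : Γ.IsTrajectory s c) :
    Γ'.IsTrajectory s (fun t => Φ.total (c t)) := by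
  obtain ⟨q, hq, hd⟩ := hc
  have hψ : ∀ p, Φ.total (ι p) = ι' (ψ p) := fun p => congrArg Sigma.fst (h p)
  refine ⟨fun t => ψ (q t), fun t ht => (congrArg Φ.total (hq t ht)).trans (hψ _), fun t ht => ?_⟩
  -- The chain rule gives velocity `TΦ(ρ¹(Γ))`, and the second component of the intertwining
  -- relation identifies it with `ρ¹(Γ')`.
  have h1 := (Φ.mdifferentiableAt_total (ι (q t))).hasMFDerivAt.comp_hasMFDerivWithinAt t (hd t ht)
  have h2 : Φ.total ∘ (fun u => ι (q u)) = fun u => ι' (ψ (q u)) := funext fun u => hψ (q u)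
  have h3 : (mfderiv (totalModel n F) (totalModel n' F') Φ.total (ι (q t)) (Γ.val (q t)).1.2 :
      EuclideanSpace ℝ (Fin n') × F') = (Γ'.val (ψ (q t))).1.2 :=
    congrArg (fun z : Σ a : TotalSpace F' E', E' a.1 × TangentSpace (totalModel n' F') a =>
      (z.2.2 : EuclideanSpace ℝ (Fin n') × F')) (h (q t))
  rw [h2] at h1
  have h4 : (mfderiv (totalModel n F) (totalModel n' F') Φ.total (ι (q t))).comp
      ((1 : ℝ →L[ℝ] ℝ).smulRight ((Γ.val (q t)).1.2 : EuclideanSpace ℝ (Fin n) × F)) =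
      (1 : ℝ →L[ℝ] ℝ).smulRight ((Γ'.val (ψ (q t))).1.2 : EuclideanSpace ℝ (Fin n') × F') := by
    refine ContinuousLinearMap.ext (M₁ := ℝ) (M₂ := EuclideanSpace ℝ (Fin n') × F') fun r => ?_
    exact (map_smul (mfderiv (totalModel n F) (totalModel n' F') Φ.total (ι (q t))) r
      (Γ.val (q t)).1.2).trans (congrArg (r • ·) h3)
  exact h4 ▸ h1

end Correspondence
end SmoothBundleMap
end ConstrainedSystems

end

/-! ### The reduction theorem. -/

theorem mainTheorem12
    -- the Lie algebroid `E → B`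
    {n : ℕ} {B : Type*} [TopologicalSpace B] [T2Space B]
    [ChartedSpace (EuclideanSpace ℝ (Fin n)) B] [IsManifold (𝓡 n) ∞ B]
    {F : Type*} [NormedAddCommGroup F] [NormedSpace ℝ F] [FiniteDimensional ℝ F]
    {E : B → Type*} [TopologicalSpace (TotalSpace F E)]
    [∀ x, AddCommGroup (E x)] [∀ x, Module ℝ (E x)] [∀ x, TopologicalSpace (E x)]
    [FiberBundle F E] [VectorBundle ℝ F E] [ContMDiffVectorBundle ∞ F E (𝓡 n)]
    (A : LieAlgebroid n F E)
    -- the Lie algebroid `E' → B'`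
    {n' : ℕ} {B' : Type*} [TopologicalSpace B'] [T2Space B']
    [ChartedSpace (EuclideanSpace ℝ (Fin n')) B'] [IsManifold (𝓡 n') ∞ B']
    {F' : Type*} [NormedAddCommGroup F'] [NormedSpace ℝ F'] [FiniteDimensional ℝ F']
    {E' : B' → Type*} [TopologicalSpace (TotalSpace F' E')]
    [∀ x, AddCommGroup (E' x)] [∀ x, Module ℝ (E' x)] [∀ x, TopologicalSpace (E' x)]
    [FiberBundle F' E'] [VectorBundle ℝ F' E'] [ContMDiffVectorBundle ∞ F' E' (𝓡 n')]
    (A' : LieAlgebroid n' F' E')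
    -- the constraint submanifolds `N ⊆ E` and `N' ⊆ E'`
    {k : ℕ} {N : Type*} [TopologicalSpace N] [T2Space N]
    [ChartedSpace (EuclideanSpace ℝ (Fin k)) N] [IsManifold (𝓡 k) ∞ N]
    (ι : N → TotalSpace F E) (hι : IsConstraintSubmanifold n k ι)
    {k' : ℕ} {N' : Type*} [TopologicalSpace N'] [T2Space N']
    [ChartedSpace (EuclideanSpace ℝ (Fin k')) N'] [IsManifold (𝓡 k') ∞ N']
    (ι' : N' → TotalSpace F' E') (hι' : IsConstraintSubmanifold n' k' ι')
    -- the Lagrangians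
    (L : TotalSpace F E → ℝ) (hL : ContMDiff (totalModel n F) 𝓘(ℝ, ℝ) ∞ L)
    (L' : TotalSpace F' E' → ℝ) (hL' : ContMDiff (totalModel n' F') 𝓘(ℝ, ℝ) ∞ L')
    (hLreg : A.IsRegularLagrangian L)
    (hreg : A.IsRegularConstrained k L ι)
    -- the fibrewise surjective morphism of Lie algebroids over a surjective submersion
    (Φ : SmoothBundleMap n F E n' F' E') (hΦ : Φ.IsMorphism A A')
    (hΦ_surj : ∀ m, Function.Surjective (Φ.fib m))
    (hbase_surj : Function.Surjective Φ.base) (hbase : IsSubmersion (𝓡 n) (𝓡 n') ∞ Φ.base)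
    -- (i)
    (hLL' : ∀ a, L a = L' (Φ.total a))
    -- (ii) `ψ` is the restriction of `Φ` to the constraint submanifolds
    (ψ : N → N') (hψ : ∀ p, ι' (ψ p) = Φ.total (ι p))
    (hψ_surj : Function.Surjective ψ) (hψ_sub : IsSubmersion (𝓡 k) (𝓡 k') ∞ ψ)
    -- (iii)
    (hV : ∀ p, Φ.total '' virtualDisplacements n k ι p =
      virtualDisplacements n' k' ι' (ψ p)) :
    A'.IsRegularLagrangian L' ∧ A'.IsRegularConstrained k' L' ι' ∧
    ∀ (Γ : A.ConstrainedSec k ι) (Γ' : A'.ConstrainedSec k' ι'),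
      Γ.IsSolution L → Γ'.IsSolution L' →
        (∀ p, Φ.prolMap ⟨ι p, (Γ.val p).1⟩ = ⟨ι' (ψ p), (Γ'.val (ψ p)).1⟩) ∧
        ∀ (s : Set ℝ) (c : ℝ → TotalSpace F E),
          Γ.IsTrajectory s c → Γ'.IsTrajectory s (fun t => Φ.total (c t)) := by
  have hΦ' := hΦ.isLowDegreeMorphism
  have hιs := hι.isSmoothEmbedding.contMDiff
  have hψs := hψ_sub.contMDiff
  have hcompat := fun p => SmoothBundleMap.tangentCompatible_constraint hι hι' hψ hψ_sub hV p
  obtain ⟨Γ₀, hΓ₀, huniq⟩ := hreg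
  -- Each solution below lifts to a solution above, which is `Γ₀` by uniqueness. As `ψ` is
  -- surjective, this determines the solution below, and it is also the asserted relation between
  -- the dynamics.
  have hlift : ∀ Γ' : A'.ConstrainedSec k' ι', Γ'.IsSolution L' →
      ∀ p, Φ.prolMap ⟨ι p, (Γ₀.val p).1⟩ = ⟨ι' (ψ p), (Γ'.val (ψ p)).1⟩ := by
    intro Γ' hΓ'
    obtain ⟨Γ, hΓ, h⟩ := SmoothBundleMap.exists_isSolution_lift hcompat hΦ' hΦ_surj hL hL' hLL'
      hLreg hιs hψs Γ' hΓ'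
    obtain rfl := huniq Γ hΓ
    exact h
  obtain ⟨Γ₁, hΓ₁⟩ := SmoothBundleMap.exists_isSolution_map hcompat hΦ' hΦ_surj hL hL' hLL'
    hLreg hιs hψ_surj hψ_sub Γ₀ hΓ₀ huniq
  refine ⟨hΦ'.isRegularLagrangian hΦ_surj hbase_surj hL' hLL' hLreg,
    ⟨Γ₁, hΓ₁, fun Γ₂ hΓ₂ => LieAlgebroid.ConstrainedSec.ext_val fun q => ?_⟩,
    fun Γ Γ' hΓ hΓ' => ?_⟩
  · obtain ⟨p, rfl⟩ := hψ_surj q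
    have h := (hlift Γ₂ hΓ₂ p).symm.trans (hlift Γ₁ hΓ₁ p)
    exact Subtype.ext (eq_of_heq (Sigma.mk.inj h).2)
  · obtain rfl := huniq Γ hΓ
    exact ⟨hlift Γ' hΓ', fun s c hc => SmoothBundleMap.isTrajectory_map (hlift Γ' hΓ') hc⟩
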